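/- **Setting.** Let $\mathcal A,\mathcal B,\mathcal C$ be unital $C^*$-algebras, let $\mathcal D=\mathcal B\otimes\mathcal C$ be the minimal $C^*$-tensor product, let $\mathbf E$ be an $\mathcal A$-$\mathcal B$ correspondence (a right Hilbert $\mathcal B$-module with a unital $*$-homomorphism of $\mathcal A$ into the adjointable operators of $\mathbf E$), let $\mathbf G$ be a Hilbert $\mathcal C$-module, and let $\mathbf H=\mathbf E\otimes\mathbf G$ be their exterior tensor product, a Hilbert $\mathcal D$-module. Inner products are linear in the second variable. Let $(X,\mu)$ be a finite measure space. Let $F_0,F_1,\dots:X\to\mathbf E$ (a finite or countably infinite family) be strongly measurable functions for which $x\mapsto\langle F_k(x)|F_k(x)\rangle$ is Bochner integrable and $$\int_X F_k(x)\,\langle F_\ell(x)|e\rangle\,d\mu(x)=\delta_{k\ell}\,e\qquad(e\in\mathbf E),$$ and let $\phi_0,\phi_1,\dots\in\mathbf G$ be a family of the same cardinality with $\langle\phi_k|\phi_\ell\rangle=\delta_{k\ell}\,1_{\mathcal C}$ and $\sum_k\phi_k\langle\phi_k|g\rangle=g$ for $g\in\mathbf G$. Assume that for every $x\in X$ the sum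 $$|x\rangle=\sum_k F_k(x)\otimes\phi_k\in\mathbf H$$ converges, and put $K(x,y)=\langle x|y\rangle\in\mathcal D$. Let $\widetilde{\mathfrak H}$ be the Hilbert $\mathcal D$-module of square integrable maps $X\to\mathcal D$, that is, the completion of the space of strongly measurable $h:X\to\mathcal D$ with $\int\|h\|^2d\mu<\infty$ under $\langle h_1|h_2\rangle=\int_X h_1(x)^*h_2(x)\,d\mu(x)$. For measurable $\Delta\subseteq X$ let $\widetilde P(\Delta)$ be the extension to $\widetilde{\mathfrak H}$ of multiplication by $\chi_\Delta$. We say that $\eta\in\widetilde{\mathfrak H}$ *is represented by* a strongly measurable function $h:X\to\mathcal D$ if $\widetilde P(\Delta)\eta=\chi_\Delta h$ for every measurable $\Delta$ for which $\chi_\Delta h$ is square integrable. Integrals $\int f\,d\mu$ of $\mathcal D$-valued functions below are weak: $\int f\,d\mu=d$ means that $\varphi\circ f$ is integrable with $\int\varphi(f(x))\,d\mu(x)=\varphi(d)$ for every positive functional $\varphi$ on $\mathcal D$. **Statement.** 1. There is exactly one isometric $\mathcal D$-linear map $W:\mathbf H\to\widetilde{\mathfrak H}$ such that $Wf$ is represented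 by $x\mapsto\langle x|f\rangle$ for all $f\in\mathbf H$. Let $\mathfrak H_K$ be its range and $\mathbf h_x=W|x\rangle$. 2. There is exactly one bounded operator $\mathbb P_K$ on $\widetilde{\mathfrak H}$ such that, for every square integrable $h$, $\mathbb P_Kh$ is represented by a function whose value at every $x$ is $\int_X K(x,y)h(y)\,d\mu(y)$; it is an adjointable self-adjoint projection of $\widetilde{\mathfrak H}$ with range $\mathfrak H_K$. 3. There is exactly one family of bounded operators $\nu(\Delta)=\int_\Delta|\mathbf h_x\rangle\langle\mathbf h_x|\,d\mu(x)$ on $\mathfrak H_K$ ($\Delta$ measurable), in the sense that $\langle f|\nu(\Delta)g\rangle=\int_\Delta\langle f|\mathbf h_x\rangle\langle\mathbf h_x|g\rangle\,d\mu(x)$ for $f,g\in\mathfrak H_K$. It is a POV measure: each $\nu(\Delta)$ is adjointable and positive, $\nu(X)=1$, and $\nu$ is strongly countably additive. 4. $\widetilde P$ is a PV measure on $\widetilde{\mathfrak H}$: a POV measure with $\widetilde P(\Delta\cap\Delta')=\widetilde P(\Delta)\widetilde P(\Delta')$. 5. (Dilation) $\nu(\Delta)f=\mathbb P_K\,\widetilde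 P(\Delta)\,\mathbb P_K f$ for every measurable $\Delta$ and every $f\in\mathfrak H_K$. 6. (Minimality) If moreover $X$ is a locally compact space with its Borel $\sigma$-algebra, every non-empty open set has positive measure, and $K(x,x)=\langle x|x\rangle$ is invertible in $\mathcal D$ for every $x\in X$, then the dilation is minimal in the sense of Naimark: the vectors $\widetilde P(\Delta)\mathbf h$, with $\Delta\subseteq X$ Borel and $\mathbf h\in\mathfrak H_K$, span a dense subspace of $\widetilde{\mathfrak H}$. -/

import Mathlib

open scoped TensorProduct InnerProductSpace ComplexOrder ENNReal RightActions
open MeasureTheory UniformSpace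

noncomputable section

section HilbertTensor

variable (K L : Type*) [NormedAddCommGroup K] [InnerProductSpace ℂ K]
  [NormedAddCommGroup L] [InnerProductSpace ℂ L]

/-- The Hilbert space tensor product of `K` and `L`. -/
def HilbertTensor := Completion (K ⊗[ℂ] L)

instance : NormedAddCommGroup (HilbertTensor K L) :=
  inferInstanceAs (NormedAddCommGroup (Completion (K ⊗[ℂ] L)))
instance : InnerProductSpace ℂ (HilbertTensor K L) :=
  inferInstanceAs (InnerProductSpace ℂ (Completion (K ⊗[ℂ] L)))
instance : CompleteSpace (HilbertTensor K L) :=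
  inferInstanceAs (CompleteSpace (Completion (K ⊗[ℂ] L)))

namespace HilbertTensor

variable {K L}

/-- The embedding of the algebraic tensor product. -/
def of : K ⊗[ℂ] L →L[ℂ] HilbertTensor K L := Completion.toComplL

theorem denseRange_of : DenseRange (of (K := K) (L := L)) := Completion.denseRange_coe

theorem inner_of (x y : K ⊗[ℂ] L) : ⟪of x, of y⟫_ℂ = ⟪x, y⟫_ℂ := Completion.inner_coe x y

/-- The operator `S ⊗ T` on the Hilbert space tensor product. -/
def map (S : K →L[ℂ] K) (T : L →L[ℂ] L) : HilbertTensor K L →L[ℂ] HilbertTensor K L :=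
  (TensorProduct.mapL S T).completion

theorem map_of (S : K →L[ℂ] K) (T : L →L[ℂ] L) (x : K ⊗[ℂ] L) :
    map S T (of x) = of (TensorProduct.mapL S T x) :=
  ContinuousLinearMap.completion_apply_coe _ _

theorem map_tmul (S : K →L[ℂ] K) (T : L →L[ℂ] L) (u : K) (w : L) :
    map S T (of (u ⊗ₜ w)) = of (S u ⊗ₜ T w) :=
  map_of _ _ _

theorem op_ext {S T : HilbertTensor K L →L[ℂ] HilbertTensor K L}
    (h : ∀ u w, S (of (u ⊗ₜ w)) = T (of (u ⊗ₜ w))) : S = T := by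
  refine ContinuousLinearMap.ext fun x => ?_
  refine denseRange_of.induction_on (p := fun x => S x = T x) x
    (isClosed_eq S.continuous T.continuous) fun y => ?_
  induction y using TensorProduct.induction_on with
  | zero => simp
  | tmul u w => exact h u w
  | add x y hx hy => rw [map_add, map_add, map_add, hx, hy]

end HilbertTensor

end HilbertTensor

section MinimalTensor

variable (A : Type*) [CStarAlgebra A] [PartialOrder A] [StarOrderedRing A]

/-- The Hilbert space of the universal representation of a C⋆-algebra: the Hilbert sum of the GNS
spaces of all its positive functionals. -/
abbrev UniversalSpace := lp (fun f : A →ₚ[ℂ] ℂ => f.GNS) 2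

variable {A}

theorem memlp_gns (a : A) (x : UniversalSpace A) :
    Memℓp (fun f : A →ₚ[ℂ] ℂ => f.gnsStarAlgHom a (x f)) 2 := by
  refine Memℓp.mono (g := fun f => ‖a‖ * ‖x f‖) ?_ fun f => ?_
  · exact (memℓp_norm_iff.mpr (lp.memℓp x)).const_mul ‖a‖
  · refine ((f.gnsStarAlgHom a).le_opNorm _).trans ?_
    gcongr
    exact NonUnitalStarAlgHom.norm_apply_le f.gnsStarAlgHom a

/-- The universal representation: `a` acts on every GNS space by its GNS operator. -/
def universalRep (a : A) : UniversalSpace A →L[ℂ] UniversalSpace A :=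
  LinearMap.mkContinuous
    { toFun := fun x => ⟨fun f => f.gnsStarAlgHom a (x f), memlp_gns a x⟩
      map_add' := fun x y => by
        ext f; exact map_add (f.gnsStarAlgHom a) (x f) (y f)
      map_smul' := fun c x => by ext f; simp } ‖a‖ fun x => by
    refine lp.norm_le_of_tsum_le (p := 2) (by norm_num) (by positivity) ?_
    have h2 : (2 : ℝ≥0∞).toReal = 2 := by norm_num
    have hs := (lp.hasSum_norm (p := 2) (by norm_num) x)
    rw [Real.mul_rpow (by positivity) (by positivity)]
    rw [← hs.tsum_eq, ← tsum_mul_left]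
    have hle : ∀ f : A →ₚ[ℂ] ℂ, ‖f.gnsStarAlgHom a (x f)‖ ^ (2 : ℝ≥0∞).toReal ≤
        ‖a‖ ^ (2 : ℝ≥0∞).toReal * ‖x f‖ ^ (2 : ℝ≥0∞).toReal := fun f => by
      rw [← Real.mul_rpow (by positivity) (by positivity)]
      refine Real.rpow_le_rpow (by positivity) ?_ (by positivity)
      refine ((f.gnsStarAlgHom a).le_opNorm _).trans ?_
      gcongr
      exact NonUnitalStarAlgHom.norm_apply_le f.gnsStarAlgHom a
    exact ((memlp_gns a x).summable (by norm_num)).tsum_le_tsum hle (hs.summable.mul_left _)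

theorem universalRep_apply (a : A) (x : UniversalSpace A) (f : A →ₚ[ℂ] ℂ) :
    universalRep a x f = f.gnsStarAlgHom a (x f) := rfl

theorem universalRep_add (a b : A) : universalRep (a + b) = universalRep a + universalRep b := by
  ext x f; simp [universalRep_apply]

theorem universalRep_smul (c : ℂ) (a : A) : universalRep (c • a) = c • universalRep a := by
  ext x f; simp [universalRep_apply]

theorem universalRep_mul (a b : A) : universalRep (a * b) = universalRep a * universalRep b := by
  ext x f; simp [universalRep_apply]

theorem universalRep_one : universalRep (1 : A) = 1 := by
  ext x f; simp [universalRep_apply]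

theorem universalRep_star_inner (a : A) (x y : UniversalSpace A) :
    ⟪universalRep (star a) x, y⟫_ℂ = ⟪x, universalRep a y⟫_ℂ := by
  rw [lp.inner_eq_tsum, lp.inner_eq_tsum]
  congr 1; ext f
  rw [universalRep_apply, universalRep_apply, map_star, ContinuousLinearMap.star_eq_adjoint,
    ContinuousLinearMap.adjoint_inner_left]

variable {B C : Type*} [CStarAlgebra B] [PartialOrder B] [StarOrderedRing B]
  [CStarAlgebra C] [PartialOrder C] [StarOrderedRing C]

open HilbertTensor in
/-- The operator `π(b) ⊗ ρ(c)`, where `π` and `ρ` are the universal representations. -/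
def spatialRep (b : B) (c : C) :
    HilbertTensor (UniversalSpace B) (UniversalSpace C) →L[ℂ]
      HilbertTensor (UniversalSpace B) (UniversalSpace C) :=
  map (universalRep b) (universalRep c)

open HilbertTensor in
theorem spatialRep_tmul (b : B) (c : C) (u : UniversalSpace B) (w : UniversalSpace C) :
    spatialRep b c (of (u ⊗ₜ w)) = of (universalRep b u ⊗ₜ universalRep c w) :=
  map_tmul _ _ _ _

open HilbertTensor in
theorem spatialRep_star (b : B) (c : C) :
    star (spatialRep b c) = spatialRep (star b) (star c) := by
  symm
  rw [ContinuousLinearMap.star_eq_adjoint, ContinuousLinearMap.eq_adjoint_iff]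
  intro x y
  refine denseRange_of.induction_on₂ (p := fun x y =>
    ⟪spatialRep (star b) (star c) x, y⟫_ℂ = ⟪x, spatialRep b c y⟫_ℂ) ?_ (fun x y => ?_) x y
  · apply isClosed_eq <;> fun_prop
  · induction x using TensorProduct.induction_on with
    | zero => simp
    | add x x' hx hx' => simp only [map_add, inner_add_left, hx, hx']
    | tmul u w =>
      induction y using TensorProduct.induction_on with
      | zero => simp
      | add y y' hy hy' => simp only [map_add, inner_add_right, hy, hy']
      | tmul u' w' =>
        rw [spatialRep_tmul, spatialRep_tmul, inner_of, inner_of, TensorProduct.inner_tmul,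
          TensorProduct.inner_tmul, universalRep_star_inner, universalRep_star_inner]

variable (B C) in
/-- The minimal (spatial) C⋆-tensor product `B ⊗ C`: the C⋆-algebra of operators generated by the
`π(b) ⊗ ρ(c)`, where `π` and `ρ` are the universal representations. -/
def MinTensor : Type _ :=
  (StarAlgebra.adjoin ℂ
    (Set.range fun p : B × C => spatialRep p.1 p.2)).topologicalClosure

variable (B C) in
/-- The C⋆-algebra structure of `B ⊗ C`, inherited from the algebra of bounded operators. -/
def MinTensor.cstarAlgebra : CStarAlgebra (MinTensor B C) :=
  StarSubalgebra.cstarAlgebra _ (h_closed := StarSubalgebra.isClosed_topologicalClosure _)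

instance : CStarAlgebra (MinTensor B C) := MinTensor.cstarAlgebra B C

instance : PartialOrder (MinTensor B C) := CStarAlgebra.spectralOrder _
instance : StarOrderedRing (MinTensor B C) := CStarAlgebra.spectralOrderedRing _

namespace MinTensor

open HilbertTensor

/-- The inclusion of `B ⊗ C` into the operators on the tensor product Hilbert space. -/
def toOperator : MinTensor B C →⋆ₐ[ℂ]
    (HilbertTensor (UniversalSpace B) (UniversalSpace C) →L[ℂ]
      HilbertTensor (UniversalSpace B) (UniversalSpace C)) :=
  StarSubalgebra.subtype _

theorem toOperator_injective : Function.Injective (toOperator (B := B) (C := C)) :=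
  Subtype.val_injective

theorem norm_toOperator (d : MinTensor B C) : ‖toOperator d‖ = ‖d‖ := rfl

theorem toOperator_add (d d' : MinTensor B C) :
    toOperator (d + d') = toOperator d + toOperator d' := rfl

theorem inner_toOperator (d t d' : MinTensor B C)
    (v w : HilbertTensor (UniversalSpace B) (UniversalSpace C)) :
    ⟪v, toOperator (star d * t * d') w⟫_ℂ =
      ⟪toOperator d v, toOperator t (toOperator d' w)⟫_ℂ :=
  ContinuousLinearMap.adjoint_inner_right (toOperator d) v (toOperator t (toOperator d' w))

theorem inner_toOperator_sum {ι : Type*} (s : Finset ι) (d : ι → MinTensor B C)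
    (v w : HilbertTensor (UniversalSpace B) (UniversalSpace C)) :
    ⟪v, toOperator (∑ i ∈ s, d i) w⟫_ℂ = ∑ i ∈ s, ⟪v, toOperator (d i) w⟫_ℂ :=
  map_sum (AddMonoidHom.mk' (fun d : MinTensor B C => ⟪v, toOperator d w⟫_ℂ) fun d d' => by
    rw [toOperator_add, ContinuousLinearMap.add_apply, inner_add_right]) _ _

/-- The elementary tensor `b ⊗ c`. -/
def tmul (b : B) (c : C) : MinTensor B C :=
  ⟨spatialRep b c, subset_closure (StarAlgebra.subset_adjoin _ _ ⟨(b, c), rfl⟩)⟩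

theorem toOperator_tmul (b : B) (c : C) : toOperator (tmul b c) = spatialRep b c := rfl

theorem tmul_mul_tmul (b b' : B) (c c' : C) : tmul b c * tmul b' c' = tmul (b * b') (c * c') :=
  toOperator_injective <| op_ext fun u w => by
    simp [toOperator_tmul, spatialRep_tmul, universalRep_mul]

theorem tmul_one_one : tmul (1 : B) (1 : C) = 1 :=
  toOperator_injective <| op_ext fun u w => by
    simp [toOperator_tmul, spatialRep_tmul, universalRep_one]

theorem star_tmul (b : B) (c : C) : star (tmul b c) = tmul (star b) (star c) :=
  toOperator_injective (by rw [map_star, toOperator_tmul, toOperator_tmul, spatialRep_star])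

theorem tmul_add (b : B) (c c' : C) : tmul b (c + c') = tmul b c + tmul b c' :=
  toOperator_injective <| op_ext fun u w => by
    simp [toOperator_tmul, spatialRep_tmul, universalRep_add, TensorProduct.tmul_add]

theorem add_tmul (b b' : B) (c : C) : tmul (b + b') c = tmul b c + tmul b' c :=
  toOperator_injective <| op_ext fun u w => by
    simp [toOperator_tmul, spatialRep_tmul, universalRep_add, TensorProduct.add_tmul]

theorem smul_tmul (z : ℂ) (b : B) (c : C) : tmul (z • b) c = z • tmul b c :=
  toOperator_injective <| op_ext fun u w => by
    simp [toOperator_tmul, spatialRep_tmul, universalRep_smul, ← TensorProduct.smul_tmul',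
      -TensorProduct.tmul_smul]

theorem tmul_smul (z : ℂ) (b : B) (c : C) : tmul b (z • c) = z • tmul b c :=
  toOperator_injective <| op_ext fun u w => by
    simp [toOperator_tmul, spatialRep_tmul, universalRep_smul]

theorem nonneg_of_isPositive {d : MinTensor B C} (hd : (toOperator d).IsPositive) : 0 ≤ d := by
  have h0 : 0 ≤ toOperator d := (ContinuousLinearMap.nonneg_iff_isPositive _).mpr hd
  have hs : IsSelfAdjoint d :=
    toOperator_injective (by rw [map_star]; exact h0.isSelfAdjoint)
  have h1 := (nonneg_iff_isSelfAdjoint_and_quasispectrumRestricts.mp h0).2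
  rw [nonneg_iff_isSelfAdjoint_and_quasispectrumRestricts]
  refine ⟨hs, ?_⟩
  rw [quasispectrumRestricts_iff_spectrumRestricts] at h1 ⊢
  rw [SpectrumRestricts.nnreal_iff_nnnorm h0.isSelfAdjoint le_rfl] at h1
  rw [SpectrumRestricts.nnreal_iff_nnnorm hs le_rfl]
  have h2 : toOperator (algebraMap ℝ _ (‖d‖₊ : ℝ) - d) =
      algebraMap ℝ _ (‖toOperator d‖₊ : ℝ) - toOperator d := by
    rw [map_sub]; congr 1
  rw [← h2] at h1
  exact h1

end MinTensor
end MinimalTensor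

section HilbertModule

/-- A right module `E` over a C⋆-algebra `A` with an `A`-valued semi-inner product, linear in the
second variable, whose seminorm is `‖x‖ = ‖⟨x, x⟩‖ ^ (1/2)`.  If `E` is a complete normed group,
then this says that `E` is a (right) Hilbert C⋆-module over `A`. -/
class InnerCStarModule (A E : Type*) [CStarAlgebra A] [PartialOrder A] [SeminormedAddCommGroup E]
    [NormedSpace ℂ E] [Module Aᵐᵒᵖ E] extends Inner A E where
  inner_add_right (x y z : E) : inner x (y + z) = inner x y + inner x z
  inner_smul_right (c : ℂ) (x y : E) : inner x (c • y) = c • inner x y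
  inner_op_smul_right (a : A) (x y : E) : inner x (y <• a) = inner x y * a
  star_inner (x y : E) : star (inner x y) = inner y x
  inner_self_nonneg (x : E) : 0 ≤ inner x x
  norm_sq_eq (x : E) : ‖x‖ ^ 2 = ‖inner x x‖

/-- An `A`-valued semi-inner product on a right `A`-module, before any norm is given. -/
structure InnerCStarModule.Core (A E : Type*) [CStarAlgebra A] [PartialOrder A] [AddCommGroup E]
    [Module ℂ E] [Module Aᵐᵒᵖ E] where
  inner : E → E → A
  inner_add_right (x y z : E) : inner x (y + z) = inner x y + inner x z
  inner_smul_right (c : ℂ) (x y : E) : inner x (c • y) = c • inner x y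
  inner_op_smul_right (a : A) (x y : E) : inner x (y <• a) = inner x y * a
  star_inner (x y : E) : star (inner x y) = inner y x
  inner_self_nonneg (x : E) : 0 ≤ inner x x

namespace InnerCStarModule.Core

variable {A E : Type*} [CStarAlgebra A] [PartialOrder A] [StarOrderedRing A] [AddCommGroup E]
    [Module ℂ E] [Module Aᵐᵒᵖ E] (c : InnerCStarModule.Core A E)

theorem inner_add_left (x y z : E) : c.inner (x + y) z = c.inner x z + c.inner y z := by
  rw [← c.star_inner, c.inner_add_right, star_add, c.star_inner, c.star_inner]

theorem inner_smul_left (t : ℂ) (x y : E) : c.inner (t • x) y = star t • c.inner x y := by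
  rw [← c.star_inner, c.inner_smul_right, star_smul, c.star_inner]

theorem inner_op_smul_left (a : A) (x y : E) : c.inner (x <• a) y = star a * c.inner x y := by
  rw [← c.star_inner, c.inner_op_smul_right, star_mul, c.star_inner]

theorem inner_neg_right (x y : E) : c.inner x (-y) = -c.inner x y := by
  have := c.inner_smul_right (-1) x y; simpa using this

theorem inner_neg_left (x y : E) : c.inner (-x) y = -c.inner x y := by
  have := c.inner_smul_left (-1) x y; simpa using this

theorem norm_inner_sq_le (x y : E) :
    ‖c.inner x y‖ ^ 2 ≤ ‖c.inner x x‖ * ‖c.inner y y‖ := by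
  set N := ‖c.inner x x‖ with hN
  set b := c.inner x y with hb
  have hN0 : 0 ≤ N := norm_nonneg _
  have key : ∀ ε : ℝ, 0 < ε → ‖b‖ ^ 2 ≤ (N + ε) * ‖c.inner y y‖ := by
    intro ε hε
    set t : ℝ := (N + ε)⁻¹ with ht
    have htpos : 0 < t := by positivity
    have h0 := c.inner_self_nonneg (x <• ((t : ℂ) • b) + -y)
    have hexp : c.inner (x <• ((t : ℂ) • b) + -y) (x <• ((t : ℂ) • b) + -y) =
        (t ^ 2) • (star b * c.inner x x * b) - (2 * t) • (star b * b) + c.inner y y := by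
      have hb' : c.inner y x = star b := by rw [hb, c.star_inner]
      simp only [c.inner_add_right, c.inner_add_left, c.inner_neg_right, c.inner_neg_left,
        c.inner_op_smul_right, c.inner_op_smul_left, hb', ← hb]
      have ht' : ∀ a : A, ((t : ℂ)) • a = t • a := fun a => by
        rw [← Complex.coe_smul]
      rw [ht', star_smul]
      simp only [star_trivial, smul_mul_assoc, mul_smul_comm, smul_smul, neg_neg, mul_assoc]
      rw [pow_two, two_mul, add_smul]
      abel
    rw [hexp] at h0
    have h1 : star b * c.inner x x * b ≤ N • (star b * b) :=
      CStarAlgebra.star_left_conjugate_le_norm_smul (hb := c.star_inner x x)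
    have h2 : (t ^ 2) • (star b * c.inner x x * b) ≤ (t ^ 2) • (N • (star b * b)) :=
      smul_le_smul_of_nonneg_left h1 (by positivity)
    have hbb : 0 ≤ star b * b := star_mul_self_nonneg b
    have h3 : (t ^ 2 * N) • (star b * b) ≤ t • (star b * b) := by
      refine smul_le_smul_of_nonneg_right ?_ hbb
      have : t * N ≤ 1 := by
        rw [ht, inv_mul_le_iff₀ (by positivity)]; linarith
      nlinarith
    have h4 : t • (star b * b) ≤ c.inner y y := by
      rw [smul_smul] at h2
      have h5 : (2 * t) • (star b * b) ≤ t • (star b * b) + c.inner y y := by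
        have := h0.trans (add_le_add_left (sub_le_sub_right (h2.trans h3) _) _)
        rwa [sub_add_eq_add_sub, sub_nonneg] at this
      rw [two_mul, add_smul] at h5
      exact le_of_add_le_add_left h5
    have h6 : t * ‖b‖ ^ 2 ≤ ‖c.inner y y‖ := by
      have := CStarAlgebra.norm_le_norm_of_nonneg_of_le (smul_nonneg htpos.le hbb) h4
      rwa [norm_smul, CStarRing.norm_star_mul_self, Real.norm_of_nonneg htpos.le, ← pow_two] at this
    rwa [ht, inv_mul_le_iff₀ (by positivity)] at h6
  refine le_of_forall_pos_le_add fun δ hδ => ?_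
  have h := key (δ / (‖c.inner y y‖ + 1)) (by positivity)
  have h7 : δ / (‖c.inner y y‖ + 1) * ‖c.inner y y‖ ≤ δ := by
    rw [div_mul_eq_mul_div, div_le_iff₀ (by positivity)]
    nlinarith [norm_nonneg (c.inner y y)]
  nlinarith

/-- The seminorm of a semi-inner product module. -/
@[reducible] def toNorm : Norm E := ⟨fun x => √‖c.inner x x‖⟩

theorem seminormCore : letI := c.toNorm; SeminormedSpace.Core ℂ E :=
  letI := c.toNorm
  { norm_nonneg := fun _ => Real.sqrt_nonneg _
    norm_smul := fun t x => by
      change √‖c.inner (t • x) (t • x)‖ = ‖t‖ * √‖c.inner x x‖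
      rw [c.inner_smul_right, c.inner_smul_left, norm_smul, norm_smul, norm_star, ← mul_assoc,
        Real.sqrt_mul (by positivity), Real.sqrt_mul_self (norm_nonneg _)]
    norm_triangle := fun x y => by
      change √‖c.inner (x + y) (x + y)‖ ≤ √‖c.inner x x‖ + √‖c.inner y y‖
      have hxy : ‖c.inner x y‖ ≤ √‖c.inner x x‖ * √‖c.inner y y‖ := by
        rw [← Real.sqrt_mul (norm_nonneg _)]
        exact Real.le_sqrt_of_sq_le (c.norm_inner_sq_le x y)
      have hyx : ‖c.inner y x‖ = ‖c.inner x y‖ := by rw [← c.star_inner, norm_star]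
      refine Real.sqrt_le_iff.mpr ⟨by positivity, ?_⟩
      have hx := Real.sq_sqrt (norm_nonneg (c.inner x x))
      have hy := Real.sq_sqrt (norm_nonneg (c.inner y y))
      calc ‖c.inner (x + y) (x + y)‖
          = ‖(c.inner x x + c.inner y x) + (c.inner x y + c.inner y y)‖ := by
            rw [c.inner_add_right, c.inner_add_left, c.inner_add_left]
        _ ≤ (‖c.inner x x‖ + ‖c.inner y x‖) + (‖c.inner x y‖ + ‖c.inner y y‖) :=
            (norm_add_le _ _).trans (add_le_add (norm_add_le _ _) (norm_add_le _ _))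
        _ ≤ _ := by rw [hyx]; nlinarith }

/-- The seminormed group structure of a semi-inner product module. -/
abbrev toSeminormedAddCommGroup : SeminormedAddCommGroup E :=
  letI := c.toNorm
  SeminormedAddCommGroup.ofCore c.seminormCore

/-- The normed space structure of a semi-inner product module. -/
abbrev toNormedSpace : letI := c.toSeminormedAddCommGroup; NormedSpace ℂ E :=
  letI := c.toSeminormedAddCommGroup
  { norm_smul_le := fun t x => (c.seminormCore.norm_smul t x).le }

/-- The semi-inner product module structure. -/
abbrev toInnerCStarModule : letI := c.toSeminormedAddCommGroup; letI := c.toNormedSpace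
    InnerCStarModule A E :=
  letI := c.toSeminormedAddCommGroup
  letI := c.toNormedSpace
  { inner := c.inner
    inner_add_right := c.inner_add_right
    inner_smul_right := c.inner_smul_right
    inner_op_smul_right := c.inner_op_smul_right
    star_inner := c.star_inner
    inner_self_nonneg := c.inner_self_nonneg
    norm_sq_eq := fun x => Real.sq_sqrt (norm_nonneg _) }

end InnerCStarModule.Core

namespace InnerCStarModule

variable {A E : Type*} [CStarAlgebra A] [PartialOrder A] [StarOrderedRing A]
  [SeminormedAddCommGroup E] [NormedSpace ℂ E] [Module Aᵐᵒᵖ E] [InnerCStarModule A E]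

variable (A E) in
/-- The semi-inner product without its norm. -/
def toCore : InnerCStarModule.Core A E where
  inner := inner A
  inner_add_right := inner_add_right
  inner_smul_right := inner_smul_right
  inner_op_smul_right := inner_op_smul_right
  star_inner := star_inner
  inner_self_nonneg := inner_self_nonneg

theorem norm_inner_le (x y : E) : ‖⟪x, y⟫_A‖ ≤ ‖x‖ * ‖y‖ := by
  refine abs_le_of_sq_le_sq' ?_ (by positivity) |>.2
  rw [mul_pow, norm_sq_eq (A := A) x, norm_sq_eq (A := A) y]
  exact (toCore A E).norm_inner_sq_le x y

theorem continuous_inner : Continuous fun p : E × E => ⟪p.1, p.2⟫_A := by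
  let f : E →+ E →+ A :=
    { toFun := fun x =>
        { toFun := fun y => ⟪x, y⟫_A
          map_zero' := by simpa using inner_smul_right (A := A) 0 x 0
          map_add' := inner_add_right x }
      map_zero' := by
        ext y
        have h : ⟪(0 : ℂ) • (0 : E), y⟫_A = star (0 : ℂ) • ⟪(0 : E), y⟫_A :=
          (toCore A E).inner_smul_left 0 0 y
        simpa using h
      map_add' := fun x y => by ext z; exact (toCore A E).inner_add_left x y z }
  refine continuous_iff_continuousAt.mpr fun ⟨x, y⟩ => ?_
  rw [ContinuousAt, tendsto_iff_norm_sub_tendsto_zero]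
  have hb : ∀ p : E × E, ‖⟪p.1, p.2⟫_A - ⟪x, y⟫_A‖ ≤ ‖p.1 - x‖ * ‖p.2‖ + ‖x‖ * ‖p.2 - y‖ := by
    intro p
    have : ⟪p.1, p.2⟫_A - ⟪x, y⟫_A = ⟪p.1 - x, p.2⟫_A + ⟪x, p.2 - y⟫_A := by
      change f p.1 p.2 - f x y = f (p.1 - x) p.2 + f x (p.2 - y)
      simp
    rw [this]
    exact (norm_add_le _ _).trans (add_le_add (norm_inner_le _ _) (norm_inner_le _ _))
  refine squeeze_zero (fun _ => norm_nonneg _) hb ?_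
  have : Continuous fun p : E × E => ‖p.1 - x‖ * ‖p.2‖ + ‖x‖ * ‖p.2 - y‖ := by fun_prop
  simpa using this.tendsto (x, y)

theorem norm_op_smul_le (a : A) (x : E) : ‖x <• a‖ ≤ ‖a‖ * ‖x‖ := by
  refine abs_le_of_sq_le_sq' ?_ (by positivity) |>.2
  rw [mul_pow, norm_sq_eq (A := A), norm_sq_eq (A := A) x, inner_op_smul_right,
    ← star_inner, inner_op_smul_right, star_mul, star_inner]
  calc ‖star a * ⟪x, x⟫_A * a‖ ≤ ‖star a‖ * ‖⟪x, x⟫_A‖ * ‖a‖ := norm_mul₃_le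
    _ = ‖a‖ ^ 2 * ‖⟪x, x⟫_A‖ := by rw [norm_star]; ring

instance uniformContinuousConstSMul : UniformContinuousConstSMul Aᵐᵒᵖ E := by
  refine ⟨fun a => ?_⟩
  exact AddMonoidHomClass.uniformContinuous_of_bound (DistribSMul.toAddMonoidHom E a) ‖a.unop‖
    fun x => norm_op_smul_le a.unop x

theorem completion_continuous_inner :
    Continuous fun p : Completion E × Completion E => ⟪p.1, p.2⟫_A := by
  let f : E →+ E →+ A :=
    { toFun := fun x =>
        { toFun := fun y => ⟪x, y⟫_A
          map_zero' := by simpa using inner_smul_right (A := A) 0 x 0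
          map_add' := inner_add_right x }
      map_zero' := by
        ext y
        have h : ⟪(0 : ℂ) • (0 : E), y⟫_A = star (0 : ℂ) • ⟪(0 : E), y⟫_A :=
          (toCore A E).inner_smul_left 0 0 y
        simpa using h
      map_add' := fun x y => by ext z; exact (toCore A E).inner_add_left x y z }
  have : Continuous fun p : E × E => f p.1 p.2 := continuous_inner
  exact (Completion.isDenseInducing_toCompl E).extend_Z_bilin
    (Completion.isDenseInducing_toCompl E) this

theorem completion_inner_coe (x y : E) :
    ⟪(x : Completion E), (y : Completion E)⟫_A = ⟪x, y⟫_A :=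
  (Completion.isDenseInducing_coe.prodMap Completion.isDenseInducing_coe).extend_eq
    (continuous_inner (A := A) (E := E)) (x, y)

theorem completion_inner {T : Type*} [TopologicalSpace T] {f g : T → Completion E}
    (hf : Continuous f) (hg : Continuous g) : Continuous fun t => ⟪f t, g t⟫_A :=
  completion_continuous_inner.comp (hf.prodMk hg)

theorem completion_op_smul_coe (a : A) (x : E) :
    ((x <• a : E) : Completion E) = (x : Completion E) <• a :=
  Completion.coe_smul _ _

/-- The completion of a semi-inner product module is a Hilbert C⋆-module. -/
instance completion : InnerCStarModule A (Completion E) where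
  inner_add_right x y z := by
    induction x, y, z using Completion.induction_on₃ with
    | hp =>
      exact isClosed_eq (completion_inner (by fun_prop) (by fun_prop))
        ((completion_inner (by fun_prop) (by fun_prop)).add
          (completion_inner (by fun_prop) (by fun_prop)))
    | ih x y z =>
      rw [← Completion.coe_add, completion_inner_coe, completion_inner_coe, completion_inner_coe,
        inner_add_right]
  inner_smul_right c x y := by
    induction x, y using Completion.induction_on₂ with
    | hp =>
      exact isClosed_eq (completion_inner (by fun_prop) (continuous_snd.const_smul c))
        ((completion_inner (by fun_prop) (by fun_prop)).const_smul c)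
    | ih x y =>
      rw [← Completion.coe_smul, completion_inner_coe, completion_inner_coe, inner_smul_right]
  inner_op_smul_right a x y := by
    induction x, y using Completion.induction_on₂ with
    | hp =>
      exact isClosed_eq (completion_inner (by fun_prop)
        ((uniformContinuous_const_smul (MulOpposite.op a)).continuous.comp continuous_snd))
        ((completion_inner (by fun_prop) (by fun_prop)).mul continuous_const)
    | ih x y =>
      rw [← completion_op_smul_coe, completion_inner_coe, completion_inner_coe,
        inner_op_smul_right]
  star_inner x y := by
    induction x, y using Completion.induction_on₂ with
    | hp =>
      exact isClosed_eq (continuous_star.comp (completion_inner (by fun_prop) (by fun_prop)))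
        (completion_inner (by fun_prop) (by fun_prop))
    | ih x y => rw [completion_inner_coe, completion_inner_coe, star_inner]
  inner_self_nonneg x := by
    induction x using Completion.induction_on with
    | hp => exact isClosed_le continuous_const (completion_inner (by fun_prop) (by fun_prop))
    | ih x => rw [completion_inner_coe]; exact inner_self_nonneg x
  norm_sq_eq x := by
    induction x using Completion.induction_on with
    | hp =>
      exact isClosed_eq (by fun_prop) (completion_inner (by fun_prop) (by fun_prop)).norm
    | ih x => rw [completion_inner_coe, Completion.norm_coe, norm_sq_eq (A := A)]

end InnerCStarModule

end HilbertModule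

section ExteriorTensor

namespace InnerCStarModule

variable {A E : Type*} [CStarAlgebra A] [PartialOrder A] [StarOrderedRing A]
  [SeminormedAddCommGroup E] [NormedSpace ℂ E] [Module Aᵐᵒᵖ E] [InnerCStarModule A E]

theorem inner_sum_right {ι : Type*} (s : Finset ι) (x : E) (y : ι → E) :
    ⟪x, ∑ i ∈ s, y i⟫_A = ∑ i ∈ s, ⟪x, y i⟫_A :=
  map_sum (AddMonoidHom.mk' (fun y => ⟪x, y⟫_A) (inner_add_right x)) _ _

theorem inner_sum_left {ι : Type*} (s : Finset ι) (x : ι → E) (y : E) :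
    ⟪∑ i ∈ s, x i, y⟫_A = ∑ i ∈ s, ⟪x i, y⟫_A :=
  map_sum (AddMonoidHom.mk' (fun x => ⟪x, y⟫_A) fun x x' => (toCore A E).inner_add_left x x' y) _ _

theorem gns_kernel_nonneg {ι : Type*} [Fintype ι] (f : A →ₚ[ℂ] ℂ) (e : ι → E) (u : ι → f.GNS) :
    0 ≤ ∑ i, ∑ j, ⟪u i, f.gnsStarAlgHom ⟪e i, e j⟫_A (u j)⟫_ℂ := by
  have hd : DenseRange fun (b : ι → f.PreGNS) (i : ι) => (b i : f.GNS) :=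
    DenseRange.piMap fun _ => Completion.denseRange_coe
  refine hd.induction_on (p := fun u : ι → f.GNS =>
    0 ≤ ∑ i, ∑ j, ⟪u i, f.gnsStarAlgHom ⟪e i, e j⟫_A (u j)⟫_ℂ) u
    (isClosed_le continuous_const (by fun_prop)) fun b => ?_
  have h : ∀ i j, ⟪(b i : f.GNS), f.gnsStarAlgHom ⟪e i, e j⟫_A (b j : f.GNS)⟫_ℂ =
      f ⟪e i <• f.ofPreGNS (b i), e j <• f.ofPreGNS (b j)⟫_A := fun i j => by
    rw [show f.gnsStarAlgHom ⟪e i, e j⟫_A (b j : f.GNS) =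
        (f.leftMulMapPreGNS ⟪e i, e j⟫_A (b j) : f.GNS) from
        f.gnsNonUnitalStarAlgHom_apply_coe, Completion.inner_coe, PositiveLinearMap.preGNS_inner_def, inner_op_smul_right,
      show ⟪e i <• f.ofPreGNS (b i), e j⟫_A = star (f.ofPreGNS (b i)) * ⟪e i, e j⟫_A from
        (toCore A E).inner_op_smul_left _ _ _]
    simp [mul_assoc]
  simp only [h, ← map_sum, ← inner_sum_right, ← inner_sum_left]
  exact map_nonneg f (inner_self_nonneg _)

theorem universal_kernel_nonneg {ι : Type*} [Fintype ι] (e : ι → E) (u : ι → UniversalSpace A) :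
    0 ≤ ∑ i, ∑ j, ⟪u i, universalRep ⟪e i, e j⟫_A (u j)⟫_ℂ := by
  have h : HasSum (fun f : A →ₚ[ℂ] ℂ =>
      ∑ i, ∑ j, ⟪u i f, f.gnsStarAlgHom ⟪e i, e j⟫_A (u j f)⟫_ℂ)
      (∑ i, ∑ j, ⟪u i, universalRep ⟪e i, e j⟫_A (u j)⟫_ℂ) :=
    hasSum_sum fun i _ => hasSum_sum fun j _ =>
      lp.hasSum_inner (u i) (universalRep ⟪e i, e j⟫_A (u j))
  exact h.nonneg fun f => gns_kernel_nonneg f e fun i => u i f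

theorem universal_kernel_posSemidef {ι : Type*} [Fintype ι] (e : ι → E)
    (u : ι → UniversalSpace A) :
    (Matrix.of fun i j => ⟪u i, universalRep ⟪e i, e j⟫_A (u j)⟫_ℂ).PosSemidef := by
  refine Matrix.posSemidef_iff_dotProduct_mulVec.mpr ⟨?_, fun x => ?_⟩
  · ext i j
    rw [Matrix.conjTranspose_apply, Matrix.of_apply, Matrix.of_apply, ← star_inner (e i) (e j),
      ← universalRep_star_inner, star_star, ← starRingEnd_apply, inner_conj_symm]
  · have h := universal_kernel_nonneg e fun i => x i • u i
    convert h using 1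
    simp only [dotProduct, Matrix.mulVec, Matrix.of_apply, Finset.mul_sum, Pi.star_apply, map_smul,
      inner_smul_left, inner_smul_right_eq_smul]
    simp [mul_comm, mul_left_comm]

end InnerCStarModule

variable {B C E G : Type*} [CStarAlgebra B] [PartialOrder B] [StarOrderedRing B]
  [CStarAlgebra C] [PartialOrder C] [StarOrderedRing C]
  [NormedAddCommGroup E] [NormedSpace ℂ E] [Module Bᵐᵒᵖ E] [InnerCStarModule B E]
  [NormedAddCommGroup G] [NormedSpace ℂ G] [Module Cᵐᵒᵖ G] [InnerCStarModule C G]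

open HilbertTensor

theorem spatial_kernel_nonneg {ι : Type*} [Fintype ι] (e : ι → E) (g : ι → G)
    (v : ι → HilbertTensor (UniversalSpace B) (UniversalSpace C)) :
    0 ≤ ∑ i, ∑ j, ⟪v i, spatialRep ⟪e i, e j⟫_B ⟪g i, g j⟫_C (v j)⟫_ℂ := by
  classical
  have hd : DenseRange fun (z : ι → UniversalSpace B ⊗[ℂ] UniversalSpace C) (i : ι) => of (z i) :=
    DenseRange.piMap fun _ => denseRange_of
  refine hd.induction_on (p := fun v : ι → HilbertTensor (UniversalSpace B) (UniversalSpace C) =>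
    0 ≤ ∑ i, ∑ j, ⟪v i, spatialRep ⟪e i, e j⟫_B ⟪g i, g j⟫_C (v j)⟫_ℂ) v
    (isClosed_le continuous_const (by fun_prop)) fun z => ?_
  choose S hS using fun i => TensorProduct.exists_finset (z i)
  let I := Σ i, S i
  have h1 := (InnerCStarModule.universal_kernel_posSemidef (fun a : I => e a.1)
    (fun a : I => a.2.1.1)).hadamard (InnerCStarModule.universal_kernel_posSemidef
      (fun a : I => g a.1) (fun a : I => a.2.1.2))
  have h2 := h1.dotProduct_mulVec_nonneg (fun _ => 1)
  convert h2 using 1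
  have h3 : ∀ i j, ⟪of (z i), spatialRep ⟪e i, e j⟫_B ⟪g i, g j⟫_C (of (z j))⟫_ℂ =
      ∑ p : S i, ∑ q : S j, ⟪p.1.1, universalRep ⟪e i, e j⟫_B q.1.1⟫_ℂ *
        ⟪p.1.2, universalRep ⟪g i, g j⟫_C q.1.2⟫_ℂ := fun i j => by
    rw [hS i, hS j]
    simp only [map_sum, sum_inner, inner_sum, spatialRep_tmul, inner_of, TensorProduct.inner_tmul]
    rw [Finset.sum_comm, ← Finset.sum_coe_sort (S i)]
    refine Finset.sum_congr rfl fun p _ => ?_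
    rw [← Finset.sum_coe_sort (S j)]
  simp only [dotProduct, Matrix.mulVec, Matrix.hadamard_apply, Matrix.of_apply, Pi.star_apply,
    star_one, one_mul, mul_one, h3]
  rw [Fintype.sum_sigma]
  refine Finset.sum_congr rfl fun i _ => ?_
  rw [Finset.sum_comm]
  refine Finset.sum_congr rfl fun p _ => ?_
  exact (Fintype.sum_sigma fun b : I =>
    ⟪p.1.1, universalRep ⟪e i, e b.1⟫_B b.2.1.1⟫_ℂ *
      ⟪p.1.2, universalRep ⟪g i, g b.1⟫_C b.2.1.2⟫_ℂ).symm

namespace ExteriorTensor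

variable (B C E G)

/-- Formal finite sums of symbols `(e ⊗ g) · d`, with `e : E`, `g : G` and `d : B ⊗ C`. -/
def Pre : Type _ := (E × G) →₀ MinTensor B C

instance : AddCommGroup (Pre B C E G) := inferInstanceAs (AddCommGroup ((E × G) →₀ MinTensor B C))
instance : Module ℂ (Pre B C E G) := inferInstanceAs (Module ℂ ((E × G) →₀ MinTensor B C))
instance : Module (MinTensor B C)ᵐᵒᵖ (Pre B C E G) :=
  inferInstanceAs (Module (MinTensor B C)ᵐᵒᵖ ((E × G) →₀ MinTensor B C))

variable {B C E G}

/-- The inner product determined by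
`⟨(e ⊗ g) · d, (e' ⊗ g') · d'⟩ = d* (⟨e, e'⟩ ⊗ ⟨g, g'⟩) d'`. -/
def preInner (x y : (E × G) →₀ MinTensor B C) : MinTensor B C :=
  x.sum fun p d => y.sum fun q d' =>
    star d * MinTensor.tmul ⟪p.1, q.1⟫_B ⟪p.2, q.2⟫_C * d'

theorem preInner_single_single (p q : E × G) (d d' : MinTensor B C) :
    preInner (Finsupp.single p d) (Finsupp.single q d') =
      star d * MinTensor.tmul ⟪p.1, q.1⟫_B ⟪p.2, q.2⟫_C * d' := by
  rw [preInner, Finsupp.sum_single_index, Finsupp.sum_single_index] <;> simp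

theorem preInner_self_nonneg (x : (E × G) →₀ MinTensor B C) : 0 ≤ preInner x x := by
  refine MinTensor.nonneg_of_isPositive ?_
  rw [ContinuousLinearMap.isPositive_iff_complex]
  intro v
  suffices h : 0 ≤ ⟪v, MinTensor.toOperator (preInner x x) v⟫_ℂ by
    rw [← inner_conj_symm, Complex.conj_eq_iff_im.mpr (Complex.nonneg_iff.mp h).2.symm]
    exact ⟨(Complex.conj_eq_iff_re.mp
      (Complex.conj_eq_iff_im.mpr (Complex.nonneg_iff.mp h).2.symm)), (Complex.nonneg_iff.mp h).1⟩
  have h := spatial_kernel_nonneg (fun i : x.support => i.1.1) (fun i : x.support => i.1.2)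
    fun i => MinTensor.toOperator (x i.1) v
  simp only [preInner, Finsupp.sum, MinTensor.inner_toOperator_sum, MinTensor.inner_toOperator,
    MinTensor.toOperator_tmul]
  rw [← Finset.sum_coe_sort]
  refine h.trans_eq (Finset.sum_congr rfl fun p _ => ?_)
  exact Finset.sum_coe_sort x.support fun q =>
    ⟪MinTensor.toOperator (x p.1) v, spatialRep ⟪p.1.1, q.1⟫_B ⟪p.1.2, q.2⟫_C
        (MinTensor.toOperator (x q) v)⟫_ℂ

theorem preInner_add_right (x y z : (E × G) →₀ MinTensor B C) :
    preInner x (y + z) = preInner x y + preInner x z := by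
  simp only [preInner]
  rw [← Finsupp.sum_add]
  refine Finsupp.sum_congr fun p _ => ?_
  rw [Finsupp.sum_add_index'] <;> simp [mul_add]

theorem preInner_smul_right (c : ℂ) (x y : (E × G) →₀ MinTensor B C) :
    preInner x (c • y) = c • preInner x y := by
  simp only [preInner]
  rw [Finsupp.smul_sum]
  refine Finsupp.sum_congr fun p _ => ?_
  rw [Finsupp.sum_smul_index' (by simp), Finsupp.smul_sum]
  simp

theorem preInner_op_smul_right (a : MinTensor B C) (x y : (E × G) →₀ MinTensor B C) :
    preInner x (MulOpposite.op a • y) = preInner x y * a := by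
  simp only [preInner]
  rw [Finsupp.sum_mul]
  refine Finsupp.sum_congr fun p _ => ?_
  rw [Finsupp.sum_smul_index' (by simp), Finsupp.sum_mul]
  simp [mul_assoc]

theorem star_preInner (x y : (E × G) →₀ MinTensor B C) :
    star (preInner x y) = preInner y x := by
  simp only [preInner, Finsupp.sum, star_sum]
  rw [Finset.sum_comm]
  refine Finset.sum_congr rfl fun q _ => Finset.sum_congr rfl fun p _ => ?_
  rw [star_mul, star_mul, star_star, MinTensor.star_tmul, InnerCStarModule.star_inner,
    InnerCStarModule.star_inner, mul_assoc]

variable (B C E G) in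
/-- The semi-inner product module structure on formal sums. -/
def core : InnerCStarModule.Core (MinTensor B C) (Pre B C E G) where
  inner := preInner
  inner_add_right := preInner_add_right
  inner_smul_right := preInner_smul_right
  inner_op_smul_right := preInner_op_smul_right
  star_inner := star_preInner
  inner_self_nonneg := preInner_self_nonneg

instance : SeminormedAddCommGroup (Pre B C E G) := (core B C E G).toSeminormedAddCommGroup
instance : NormedSpace ℂ (Pre B C E G) := (core B C E G).toNormedSpace
instance : InnerCStarModule (MinTensor B C) (Pre B C E G) := (core B C E G).toInnerCStarModule

end ExteriorTensor

variable (B C E G) in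
/-- The exterior tensor product `E ⊗ G` of the Hilbert modules `E` over `B` and `G` over `C`: the
Hilbert module over `B ⊗ C` obtained by completion (and separation) from the elementary tensors
`e ⊗ g` under `⟨e ⊗ g, e' ⊗ g'⟩ = ⟨e, e'⟩ ⊗ ⟨g, g'⟩`. -/
def ExteriorTensor : Type _ := Completion (ExteriorTensor.Pre B C E G)

namespace ExteriorTensor

instance : NormedAddCommGroup (ExteriorTensor B C E G) :=
  inferInstanceAs (NormedAddCommGroup (Completion (Pre B C E G)))
instance : NormedSpace ℂ (ExteriorTensor B C E G) :=
  inferInstanceAs (NormedSpace ℂ (Completion (Pre B C E G)))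
instance : CompleteSpace (ExteriorTensor B C E G) :=
  inferInstanceAs (CompleteSpace (Completion (Pre B C E G)))
instance : Module (MinTensor B C)ᵐᵒᵖ (ExteriorTensor B C E G) :=
  inferInstanceAs (Module (MinTensor B C)ᵐᵒᵖ (Completion (Pre B C E G)))
instance : InnerCStarModule (MinTensor B C) (ExteriorTensor B C E G) :=
  inferInstanceAs (InnerCStarModule (MinTensor B C) (Completion (Pre B C E G)))

variable (B C E G) in
/-- The embedding of the formal sums. -/
def of (x : Pre B C E G) : ExteriorTensor B C E G := Completion.coe' x

theorem of_add (x y : Pre B C E G) : of B C E G (x + y) = of B C E G x + of B C E G y :=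
  Completion.coe_add x y

theorem denseRange_of : DenseRange (of B C E G) := Completion.denseRange_coe

variable (B C) in
/-- The formal sum `(e ⊗ g) · d`. -/
def Pre.single (e : E) (g : G) (d : MinTensor B C) : Pre B C E G := Finsupp.single (e, g) d

variable (B C) in
/-- The elementary tensor `e ⊗ g`. -/
def tmul (e : E) (g : G) : ExteriorTensor B C E G := of B C E G (Pre.single B C e g 1)

theorem inner_tmul (e e' : E) (g g' : G) :
    ⟪tmul B C e g, tmul B C e' g'⟫_(MinTensor B C) =
      MinTensor.tmul ⟪e, e'⟫_B ⟪g, g'⟫_C := by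
  refine (InnerCStarModule.completion_inner_coe (A := MinTensor B C)
    (Pre.single B C e g 1) (Pre.single B C e' g' 1)).trans ?_
  refine (preInner_single_single _ _ _ _).trans ?_
  simp

theorem of_single (e : E) (g : G) (d : MinTensor B C) :
    of B C E G (Pre.single B C e g d) = tmul B C e g <• d := by
  refine Eq.trans ?_ (InnerCStarModule.completion_op_smul_coe d (Pre.single B C e g 1))
  change of B C E G _ = of B C E G _
  congr 1
  exact (congrArg (Finsupp.single (e, g)) (one_mul d).symm).trans
    (Finsupp.smul_single (MulOpposite.op d) (e, g) 1).symm

theorem dense_span_tmul :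
    Dense (Submodule.span (MinTensor B C)ᵐᵒᵖ
      (Set.range fun p : E × G => tmul B C p.1 p.2) : Set (ExteriorTensor B C E G)) := by
  refine denseRange_of.mono ?_
  rintro _ ⟨x, rfl⟩
  induction x using Finsupp.induction_linear with
  | zero => exact Submodule.zero_mem _
  | add x y hx hy =>
    exact (congrArg (· ∈ _) (of_add x y)).mpr (Submodule.add_mem _ hx hy)
  | single p d =>
    exact (congrArg (· ∈ _) (of_single p.1 p.2 d)).mpr
      (Submodule.smul_mem _ _ (Submodule.subset_span ⟨p, rfl⟩))

end ExteriorTensor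

end ExteriorTensor

section SquareIntegrable

namespace L2Module

section Pre

variable {X : Type*} [MeasurableSpace X] (μ : Measure X) (D : Type*) [CStarAlgebra D]

/-- The functions `h : X → D` for which `⟨h(x), h(x)⟩ = h(x)* h(x)` is Bochner integrable, that is
(as `‖h(x)* h(x)‖ = ‖h(x)‖ ^ 2`) the strongly measurable functions with `∫ ‖h‖ ^ 2 dμ < ∞`. -/
def preSubmodule : Submodule Dᵐᵒᵖ (X → D) where
  carrier := {h | MemLp h 2 μ}
  add_mem' := fun hf hg => MemLp.add hf hg
  zero_mem' := MemLp.zero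
  smul_mem' := fun c _ hf => MemLp.const_smul hf c

/-- The square integrable functions `X → D`, without the topology of the function space. -/
def Pre : Type _ := preSubmodule μ D

instance : AddCommGroup (Pre μ D) := inferInstanceAs (AddCommGroup (preSubmodule μ D))
instance : Module ℂ (Pre μ D) := inferInstanceAs (Module ℂ (preSubmodule μ D))
instance : Module Dᵐᵒᵖ (Pre μ D) := inferInstanceAs (Module Dᵐᵒᵖ (preSubmodule μ D))

variable {μ D}

namespace Pre

/-- A square integrable function as an element of `Pre μ D`. -/
def mk (h : X → D) (hh : MemLp h 2 μ) : Pre μ D := ⟨h, hh⟩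

/-- The underlying function. -/
def fn (f : Pre μ D) : X → D := f.1

theorem memLp (f : Pre μ D) : MemLp f.fn 2 μ := f.2

theorem ext {f g : Pre μ D} (h : f.fn = g.fn) : f = g := Subtype.ext h

theorem fn_add (f g : Pre μ D) (x : X) : (f + g).fn x = f.fn x + g.fn x := rfl
theorem fn_smul (c : ℂ) (f : Pre μ D) (x : X) : (c • f).fn x = c • f.fn x := rfl
theorem fn_op_smul (a : D) (f : Pre μ D) (x : X) : (f <• a).fn x = f.fn x * a := rfl

end Pre

theorem integrable_star_mul {f g : X → D} (hf : MemLp f 2 μ) (hg : MemLp g 2 μ) :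
    Integrable (fun x => star (f x) * g x) μ :=
  memLp_one_iff_integrable.mp (hg.mul hf.star)

end Pre

variable {X : Type*} [MeasurableSpace X] (μ : Measure X)
  (D : Type*) [CStarAlgebra D] [PartialOrder D] [StarOrderedRing D]

/-- The semi-inner product `⟨f, g⟩ = ∫ f(x)* g(x) dμ(x)`. -/
def core : InnerCStarModule.Core D (Pre μ D) where
  inner f g := ∫ x, star (f.fn x) * g.fn x ∂μ
  inner_add_right f g h := by
    rw [← integral_add (integrable_star_mul f.memLp g.memLp) (integrable_star_mul f.memLp h.memLp)]
    simp [Pre.fn_add, mul_add]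
  inner_smul_right c f g := by
    rw [← integral_smul]
    simp [Pre.fn_smul]
  inner_op_smul_right a f g := by
    rw [← integral_mul_const_of_integrable (integrable_star_mul f.memLp g.memLp)]
    simp [Pre.fn_op_smul, mul_assoc]
  star_inner f g := by
    have := (starL' ℝ (A := D)).integral_comp_comm (fun x => star (f.fn x) * g.fn x) (μ := μ)
    simpa using this.symm
  inner_self_nonneg f := integral_nonneg fun x => star_mul_self_nonneg _

instance : SeminormedAddCommGroup (Pre μ D) := (core μ D).toSeminormedAddCommGroup
instance : NormedSpace ℂ (Pre μ D) := (core μ D).toNormedSpace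
instance : InnerCStarModule D (Pre μ D) := (core μ D).toInnerCStarModule

variable {μ D} in
theorem inner_pre (f g : Pre μ D) : ⟪f, g⟫_D = ∫ x, star (f.fn x) * g.fn x ∂μ := rfl

end L2Module

variable {X : Type*} [MeasurableSpace X] (μ : Measure X)
  (D : Type*) [CStarAlgebra D] [PartialOrder D] [StarOrderedRing D]

/-- The Hilbert `D`-module of square integrable maps `X → D`: the completion of `L2Module.Pre μ D`
for the norm of the inner product `⟨f, g⟩ = ∫ f(x)* g(x) dμ(x)`. -/
def L2Module : Type _ := Completion (L2Module.Pre μ D)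

namespace L2Module

instance : NormedAddCommGroup (L2Module μ D) :=
  inferInstanceAs (NormedAddCommGroup (Completion (Pre μ D)))
instance : NormedSpace ℂ (L2Module μ D) :=
  inferInstanceAs (NormedSpace ℂ (Completion (Pre μ D)))
instance : CompleteSpace (L2Module μ D) :=
  inferInstanceAs (CompleteSpace (Completion (Pre μ D)))
instance : Module Dᵐᵒᵖ (L2Module μ D) := inferInstanceAs (Module Dᵐᵒᵖ (Completion (Pre μ D)))
instance : InnerCStarModule D (L2Module μ D) :=
  inferInstanceAs (InnerCStarModule D (Completion (Pre μ D)))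

variable {μ D}

/-- The element of the Hilbert module given by a square integrable function. -/
def of (h : X → D) (hh : MemLp h 2 μ) : L2Module μ D := Completion.coe' (Pre.mk h hh)

theorem inner_of {f g : X → D} (hf : MemLp f 2 μ) (hg : MemLp g 2 μ) :
    ⟪of f hf, of g hg⟫_D = ∫ x, star (f x) * g x ∂μ :=
  InnerCStarModule.completion_inner_coe (A := D) (Pre.mk f hf) (Pre.mk g hg)

theorem norm_mk_indicator_le {Δ : Set X} (hΔ : MeasurableSet Δ) (h : Pre μ D) :
    ‖Pre.mk (Δ.indicator h.fn) (h.memLp.indicator hΔ)‖ ≤ ‖h‖ := by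
  refine abs_le_of_sq_le_sq' ?_ (norm_nonneg _) |>.2
  rw [InnerCStarModule.norm_sq_eq (A := D), InnerCStarModule.norm_sq_eq (A := D) h]
  refine CStarAlgebra.norm_le_norm_of_nonneg_of_le (InnerCStarModule.inner_self_nonneg _) ?_
  rw [inner_pre, inner_pre]
  refine integral_mono (integrable_star_mul (h.memLp.indicator hΔ) (h.memLp.indicator hΔ))
    (integrable_star_mul h.memLp h.memLp) fun x => ?_
  change star (Δ.indicator h.fn x) * Δ.indicator h.fn x ≤ star (h.fn x) * h.fn x
  by_cases hx : x ∈ Δ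
  · simp [hx]
  · simp [hx, star_mul_self_nonneg]

variable (μ D) in
/-- Multiplication by the characteristic function of `Δ` on functions. -/
def preIndicator (Δ : Set X) (hΔ : MeasurableSet Δ) : Pre μ D →L[ℂ] Pre μ D :=
  LinearMap.mkContinuous
    { toFun := fun h => Pre.mk (Δ.indicator h.fn) (h.memLp.indicator hΔ)
      map_add' := fun f g => Pre.ext (Set.indicator_add Δ f.fn g.fn)
      map_smul' := fun c f => Pre.ext (Set.indicator_const_smul Δ c f.fn) } 1 fun h =>
    (norm_mk_indicator_le hΔ h).trans_eq (one_mul _).symm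

variable (μ D) in
/-- The operator `h ↦ χ_Δ h` on the Hilbert module of square integrable maps. -/
def indicatorMul (Δ : Set X) (hΔ : MeasurableSet Δ) : L2Module μ D →L[ℂ] L2Module μ D :=
  (preIndicator μ D Δ hΔ).completion

theorem indicatorMul_of {Δ : Set X} (hΔ : MeasurableSet Δ) {h : X → D} (hh : MemLp h 2 μ) :
    indicatorMul μ D Δ hΔ (of h hh) = of (Δ.indicator h) (hh.indicator hΔ) :=
  ContinuousLinearMap.completion_apply_coe _ _

/-- The element `η` of the Hilbert module is the (class of the) function `h`, which is allowed to be
one of those elements of the completion for which `‖h‖ ^ 2` is not integrable: wherever `h` is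
square integrable, `η` is `h`.  By countable additivity this determines `η`. -/
def Represents (η : L2Module μ D) (h : X → D) : Prop :=
  AEStronglyMeasurable h μ ∧ ∀ (Δ : Set X) (hΔ : MeasurableSet Δ)
    (hm : MemLp (Δ.indicator h) 2 μ), indicatorMul μ D Δ hΔ η = of (Δ.indicator h) hm

end L2Module

variable {D} in
/-- `d` is the weak integral of `f : X → D`: `∫ φ(f(x)) dμ(x) = φ(d)` for every positive functional
`φ`.  Positive functionals span the dual of a C⋆-algebra, so this is the same as to ask it of all
bounded functionals. -/
def HasWeakIntegral (μ : Measure X) (f : X → D) (d : D) : Prop :=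
  ∀ φ : D →ₚ[ℂ] ℂ, Integrable (fun x => φ (f x)) μ ∧ ∫ x, φ (f x) ∂μ = φ d

end SquareIntegrable

section Submodule

namespace InnerCStarModule

variable {A E : Type*} [CStarAlgebra A] [PartialOrder A] [StarOrderedRing A]
  [NormedAddCommGroup E] [NormedSpace ℂ E] [Module Aᵐᵒᵖ E] [InnerCStarModule A E]

theorem ext_inner {x y : E} (h : ∀ z : E, ⟪z, x⟫_A = ⟪z, y⟫_A) : x = y := by
  have h1 : ⟪x - y, x - y⟫_A = 0 := by
    have h2 := (toCore A E).inner_add_right (x - y) x (-y)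
    rw [(toCore A E).inner_neg_right] at h2
    rw [← sub_eq_add_neg] at h2
    refine h2.trans ?_
    change ⟪x - y, x⟫_A + -⟪x - y, y⟫_A = 0
    rw [h, add_neg_cancel]
  have h3 := norm_sq_eq (A := A) (x - y)
  rw [h1, norm_zero, sq_eq_zero_iff, norm_eq_zero, sub_eq_zero] at h3
  exact h3

instance isScalarTower : IsScalarTower ℂ Aᵐᵒᵖ E := by
  refine ⟨fun c a x => ext_inner (A := A) fun z => ?_⟩
  rw [inner_smul_right]
  have h1 := inner_op_smul_right (a.unop) z x
  have h2 := inner_op_smul_right (c • a.unop) z x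
  rw [MulOpposite.op_unop] at h1
  rw [MulOpposite.op_smul, MulOpposite.op_unop] at h2
  rw [h1, h2, mul_smul_comm]

instance submodule (S : Submodule Aᵐᵒᵖ E) : InnerCStarModule A S where
  inner x y := ⟪(x : E), (y : E)⟫_A
  inner_add_right x y z := inner_add_right (x : E) y z
  inner_smul_right c x y := inner_smul_right c (x : E) y
  inner_op_smul_right a x y := inner_op_smul_right a (x : E) y
  star_inner x y := star_inner (x : E) y
  inner_self_nonneg x := inner_self_nonneg (x : E)
  norm_sq_eq x := norm_sq_eq (A := A) (x : E)

end InnerCStarModule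
end Submodule

section CoherentStates

/-- A left action of the unital C⋆-algebra `A` on the Hilbert `B`-module `E` by adjointable
operators, that is, a unital ⋆-homomorphism from `A` to the adjointable operators of `E`. -/
structure Correspondence (A B E : Type*) [CStarAlgebra A] [CStarAlgebra B] [PartialOrder B]
    [NormedAddCommGroup E] [NormedSpace ℂ E] [Module Bᵐᵒᵖ E] [InnerCStarModule B E] where
  act : A →ₐ[ℂ] (E →L[ℂ] E)
  inner_act (a : A) (x y : E) : ⟪act a x, y⟫_B = ⟪x, act (star a) y⟫_B

variable {A B C E G X κ : Type*}
  [CStarAlgebra A] [CStarAlgebra B] [PartialOrder B] [StarOrderedRing B]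
  [CStarAlgebra C] [PartialOrder C] [StarOrderedRing C]
  [NormedAddCommGroup E] [NormedSpace ℂ E] [Module Bᵐᵒᵖ E] [InnerCStarModule B E]
  [NormedAddCommGroup G] [NormedSpace ℂ G] [Module Cᵐᵒᵖ G] [InnerCStarModule C G]
  [MeasurableSpace X]

variable (B C) in
/-- The conditions on the functions `F k : X → E` and the vectors `φ k : G` from which the coherent
states are built: `F k` is measurable with `⟨F k (x), F k (x)⟩` Bochner integrable,
`∫ |F k (x)⟩⟨F l (x)| dμ(x) = δ_{kl}` on `E`, `∑ |φ k⟩⟨φ k| = 1` on `G`, `⟨φ k, φ l⟩ = δ_{kl}`, and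
the sum of the `F k (x) ⊗ φ k` converges for every `x`. -/
structure IsCoherentSystem (μ : Measure X) (F : κ → X → E) (φ : κ → G) : Prop where
  aestronglyMeasurable (k : κ) : AEStronglyMeasurable (F k) μ
  integrable_inner (k : κ) : Integrable (fun x => ⟪F k x, F k x⟫_B) μ
  integral_self (k : κ) (e : E) : ∫ x, F k x <• ⟪F k x, e⟫_B ∂μ = e
  integral_of_ne (k l : κ) (hkl : k ≠ l) (e : E) : ∫ x, F k x <• ⟪F l x, e⟫_B ∂μ = 0
  hasSum_frame (g : G) : HasSum (fun k => φ k <• ⟪φ k, g⟫_C) g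
  inner_self (k : κ) : ⟪φ k, φ k⟫_C = 1
  inner_of_ne (k l : κ) (hkl : k ≠ l) : ⟪φ k, φ l⟫_C = 0
  summable (x : X) : Summable fun k => ExteriorTensor.tmul B C (F k x) (φ k)

variable (C) in
/-- The coherent state `|x, a⟩ = ∑ (a F k (x)) ⊗ φ k` in `E ⊗ G`. -/
def ket (c : Correspondence A B E) (F : κ → X → E) (φ : κ → G) (x : X) (a : A) :
    ExteriorTensor B C E G :=
  ∑' k, ExteriorTensor.tmul B C (c.act a (F k x)) (φ k)

variable (C) in
/-- The reproducing kernel `K(x, y) = ⟨x, 1 | y, 1⟩`. -/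
def repKernel (c : Correspondence A B E) (F : κ → X → E) (φ : κ → G) (x y : X) : MinTensor B C :=
  ⟪ket C c F φ x 1, ket C c F φ y 1⟫_(MinTensor B C)

/-- `W` is the isometry `(W f)(x) = ⟨x, 1 | f⟩`. -/
def IsAnalysisMap (c : Correspondence A B E) (F : κ → X → E) (φ : κ → G) (μ : Measure X)
    (W : ExteriorTensor B C E G →ₗᵢ[(MinTensor B C)ᵐᵒᵖ] L2Module μ (MinTensor B C)) : Prop :=
  ∀ f, (W f).Represents fun x => ⟪ket C c F φ x 1, f⟫_(MinTensor B C)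

/-- `P` is the integral operator `(P h)(x) = ∫ K(x, y) h(y) dμ(y)`. -/
def IsKernelOperator {D : Type*} [CStarAlgebra D] [PartialOrder D] [StarOrderedRing D]
    (μ : Measure X) (K : X → X → D) (P : L2Module μ D →L[ℂ] L2Module μ D) : Prop :=
  ∀ (h : X → D) (hh : MemLp h 2 μ), ∃ v : X → D,
    (∀ x, HasWeakIntegral μ (fun y => K x y * h y) (v x)) ∧ (P (L2Module.of h hh)).Represents v

/-- `ν(Δ) = ∫_Δ |h_x⟩⟨h_x| dμ(x)` for all measurable `Δ`, for a family of vectors `h_x` of `M`. -/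
def IsIntegralOfKetBra (D : Type*) [CStarAlgebra D] [PartialOrder D] [StarOrderedRing D]
    {M : Type*} [NormedAddCommGroup M] [NormedSpace ℂ M] [Module Dᵐᵒᵖ M] [InnerCStarModule D M]
    (μ : Measure X) (h : X → M) (ν : ∀ Δ : Set X, MeasurableSet Δ → M →L[ℂ] M) : Prop :=
  ∀ (Δ : Set X) (hΔ : MeasurableSet Δ) (f g : M),
    HasWeakIntegral (μ.restrict Δ) (fun x => ⟪f, h x⟫_D * ⟪h x, g⟫_D) ⟪f, ν Δ hΔ g⟫_D

/-- A normalized positive operator valued measure on the Hilbert `D`-module `M`. -/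
structure IsPOVMeasure (D : Type*) [CStarAlgebra D] [PartialOrder D]
    {M : Type*} [NormedAddCommGroup M] [NormedSpace ℂ M] [Module Dᵐᵒᵖ M] [InnerCStarModule D M]
    (ν : ∀ Δ : Set X, MeasurableSet Δ → M →L[ℂ] M) : Prop where
  selfAdjoint (Δ : Set X) (hΔ : MeasurableSet Δ) (x y : M) :
    ⟪ν Δ hΔ x, y⟫_D = ⟪x, ν Δ hΔ y⟫_D
  nonneg (Δ : Set X) (hΔ : MeasurableSet Δ) (x : M) : 0 ≤ ⟪x, ν Δ hΔ x⟫_D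
  univ : ν Set.univ MeasurableSet.univ = 1
  hasSum (s : ℕ → Set X) (hs : ∀ n, MeasurableSet (s n))
    (hd : Pairwise (Function.onFun Disjoint s)) (x : M) :
    HasSum (fun n => ν (s n) (hs n) x) (ν (⋃ n, s n) (MeasurableSet.iUnion hs) x)

/-- A projection valued measure: `ν(Δ ∩ Δ') = ν(Δ) ν(Δ')`. -/
structure IsPVMeasure (D : Type*) [CStarAlgebra D] [PartialOrder D]
    {M : Type*} [NormedAddCommGroup M] [NormedSpace ℂ M] [Module Dᵐᵒᵖ M] [InnerCStarModule D M]
    (ν : ∀ Δ : Set X, MeasurableSet Δ → M →L[ℂ] M) : Prop extends IsPOVMeasure D ν where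
  inter (Δ Δ' : Set X) (hΔ : MeasurableSet Δ) (hΔ' : MeasurableSet Δ') :
    ν (Δ ∩ Δ') (hΔ.inter hΔ') = ν Δ hΔ ∘L ν Δ' hΔ'

/-- `P` is the orthogonal projection of the Hilbert module `M` onto `S`: it is adjointable,
self-adjoint and idempotent, with range `S`. -/
structure IsOrthogonalProjection {D : Type*} [CStarAlgebra D] [PartialOrder D]
    {M : Type*} [NormedAddCommGroup M] [NormedSpace ℂ M] [Module Dᵐᵒᵖ M] [InnerCStarModule D M]
    (S : Submodule Dᵐᵒᵖ M) (P : M →L[ℂ] M) : Prop where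
  selfAdjoint (x y : M) : ⟪P x, y⟫_D = ⟪x, P y⟫_D
  idempotent (x : M) : P (P x) = P x
  range_eq : Set.range P = S

/-- The dilation to `P` is minimal: the vectors `P(Δ) h`, with `h` in the submodule `S`, span a dense
subspace of the big space. -/
def IsMinimalDilation {D : Type*} [CStarAlgebra D] [PartialOrder D]
    {M : Type*} [NormedAddCommGroup M] [NormedSpace ℂ M] [Module Dᵐᵒᵖ M] [InnerCStarModule D M]
    (S : Submodule Dᵐᵒᵖ M) (P : ∀ Δ : Set X, MeasurableSet Δ → M →L[ℂ] M) : Prop :=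
  Dense (Submodule.span ℂ {v : M | ∃ (Δ : Set X) (hΔ : MeasurableSet Δ), ∃ h ∈ S, v = P Δ hΔ h} :
    Set M)

end CoherentStates

end

noncomputable section

section HilbertModuleLemmas

open Filter Topology

namespace InnerCStarModule

variable {A E : Type*} [CStarAlgebra A] [PartialOrder A] [StarOrderedRing A]

section Seminormed

variable [SeminormedAddCommGroup E] [NormedSpace ℂ E] [Module Aᵐᵒᵖ E] [InnerCStarModule A E]

theorem inner_add_left (x y z : E) : ⟪x + y, z⟫_A = ⟪x, z⟫_A + ⟪y, z⟫_A :=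
  (toCore A E).inner_add_left x y z

theorem inner_op_smul_left (a : A) (x y : E) : ⟪x <• a, y⟫_A = star a * ⟪x, y⟫_A :=
  (toCore A E).inner_op_smul_left a x y

variable (A) in
/-- The inner product with a fixed vector, as a continuous linear map. -/
def innerCLM (x : E) : E →L[ℂ] A :=
  LinearMap.mkContinuous
    { toFun := fun y => ⟪x, y⟫_A
      map_add' := inner_add_right x
      map_smul' := fun c y => inner_smul_right c x y } ‖x‖ fun y => norm_inner_le x y

@[simp] theorem innerCLM_apply (x y : E) : innerCLM A x y = ⟪x, y⟫_A := rfl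

theorem inner_zero_right (x : E) : ⟪x, (0 : E)⟫_A = 0 := (innerCLM A x).map_zero

theorem inner_zero_left (x : E) : ⟪(0 : E), x⟫_A = 0 := by
  rw [← star_inner, inner_zero_right, star_zero]

theorem inner_sub_right (x y z : E) : ⟪x, y - z⟫_A = ⟪x, y⟫_A - ⟪x, z⟫_A :=
  (innerCLM A x).map_sub y z

theorem continuous_inner_comp {T : Type*} [TopologicalSpace T] {f g : T → E}
    (hf : Continuous f) (hg : Continuous g) : Continuous fun t => ⟪f t, g t⟫_A :=
  continuous_inner.comp (hf.prodMk hg)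

theorem norm_eq_of_inner_self_eq {F : Type*} [SeminormedAddCommGroup F] [NormedSpace ℂ F]
    [Module Aᵐᵒᵖ F] [InnerCStarModule A F] {x : E} {y : F} (h : ⟪x, x⟫_A = ⟪y, y⟫_A) :
    ‖x‖ = ‖y‖ := by
  rw [← sq_eq_sq₀ (norm_nonneg _) (norm_nonneg _), norm_sq_eq (A := A), norm_sq_eq (A := A) y, h]

end Seminormed

section Normed

variable [NormedAddCommGroup E] [NormedSpace ℂ E] [Module Aᵐᵒᵖ E] [InnerCStarModule A E]

variable (A E) in
/-- The right multiplication of a Hilbert module as a continuous bilinear map. -/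
def opSMulCLM : E →L[ℂ] A →L[ℂ] E :=
  LinearMap.mkContinuous₂
    (LinearMap.mk₂ ℂ (fun (x : E) (a : A) => x <• a)
      (fun x y a => smul_add (MulOpposite.op a) x y)
      (fun c x a => ext_inner (A := A) fun z => by
        rw [inner_op_smul_right, inner_smul_right, inner_smul_right, inner_op_smul_right,
          smul_mul_assoc])
      (fun x a b => by rw [MulOpposite.op_add, add_smul])
      (fun c x a => ext_inner (A := A) fun z => by
        rw [inner_op_smul_right, inner_smul_right, inner_op_smul_right, mul_smul_comm]))
    1 fun x a => by
      rw [one_mul, mul_comm]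
      exact norm_op_smul_le a x

theorem continuous_opSMul : Continuous fun p : E × A => p.1 <• p.2 :=
  (opSMulCLM A E).continuous₂

theorem eq_zero_of_inner_self {x : E} (h : ⟪x, x⟫_A = 0) : x = 0 := by
  have := norm_sq_eq (A := A) x
  rwa [h, norm_zero, sq_eq_zero_iff, norm_eq_zero] at this

theorem norm_le_of_inner_eq {F : Type*} [NormedAddCommGroup F] [NormedSpace ℂ F]
    [Module Aᵐᵒᵖ F] [InnerCStarModule A F] {x : E} {y z : F} (h : ⟪x, x⟫_A = ⟪y, z⟫_A)
    (hy : ‖y‖ = ‖x‖) : ‖x‖ ≤ ‖z‖ := by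
  rcases (norm_nonneg x).eq_or_lt with h0 | h0
  · rw [← h0]; exact norm_nonneg _
  · refine le_of_mul_le_mul_left ?_ h0
    rw [← sq, norm_sq_eq (A := A), h, ← hy]
    exact norm_inner_le y z

end Normed

section Lift

variable {M N ι : Type*} [NormedAddCommGroup M] [NormedSpace ℂ M] [Module Aᵐᵒᵖ M]
  [InnerCStarModule A M] [NormedAddCommGroup N] [NormedSpace ℂ N] [Module Aᵐᵒᵖ N]
  [InnerCStarModule A N]

theorem inner_linearCombination (m : ι → M) (a b : ι →₀ Aᵐᵒᵖ) :
    ⟪Finsupp.linearCombination Aᵐᵒᵖ m a, Finsupp.linearCombination Aᵐᵒᵖ m b⟫_A =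
      ∑ i ∈ a.support, ∑ j ∈ b.support, star (a i).unop * (⟪m i, m j⟫_A * (b j).unop) := by
  simp only [Finsupp.linearCombination_apply, Finsupp.sum]
  rw [inner_sum_left]
  refine Finset.sum_congr rfl fun i _ => ?_
  rw [inner_sum_right]
  refine Finset.sum_congr rfl fun j _ => ?_
  have h1 := inner_op_smul_left (a i).unop (m i) (b j • m j)
  have h2 := inner_op_smul_right (b j).unop (m i) (m j)
  rw [MulOpposite.op_unop] at h1 h2
  rw [h1, h2]

/-- An isometry between Hilbert modules is determined by its values on a generating family, which
may be prescribed arbitrarily as long as the inner products agree. -/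
theorem exists_linearIsometry [CompleteSpace N] (m : ι → M) (n : ι → N)
    (hm : Dense (Submodule.span Aᵐᵒᵖ (Set.range m) : Set M))
    (hmn : ∀ i j, ⟪m i, m j⟫_A = ⟪n i, n j⟫_A) :
    ∃ W : M →ₗᵢ[Aᵐᵒᵖ] N, (∀ i, W (m i) = n i) ∧ ∀ x y, ⟪W x, W y⟫_A = ⟪x, y⟫_A := by
  let Φ := Finsupp.linearCombination Aᵐᵒᵖ m
  let Ψ := Finsupp.linearCombination Aᵐᵒᵖ n
  have hin : ∀ a b, ⟪Φ a, Φ b⟫_A = ⟪Ψ a, Ψ b⟫_A := fun a b => by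
    simp only [Φ, Ψ, inner_linearCombination, hmn]
  have hker : LinearMap.ker Φ ≤ LinearMap.ker Ψ := fun a ha => by
    rw [LinearMap.mem_ker] at ha ⊢
    refine eq_zero_of_inner_self (A := A) ?_
    rw [← hin, ha, inner_zero_right]
  let g : LinearMap.range Φ →ₗ[Aᵐᵒᵖ] N :=
    ((LinearMap.ker Φ).liftQ Ψ hker) ∘ₗ Φ.quotKerEquivRange.symm.toLinearMap
  have hg : ∀ a, g ⟨Φ a, a, rfl⟩ = Ψ a := fun a => by
    have : Φ.quotKerEquivRange.symm ⟨Φ a, a, rfl⟩ = (LinearMap.ker Φ).mkQ a :=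
      Φ.quotKerEquivRange_symm_apply_image a ⟨a, rfl⟩
    simp [g, this]
  have hgn : ∀ x, ‖g x‖ = ‖x‖ := by
    rintro ⟨_, a, rfl⟩
    rw [hg]
    exact norm_eq_of_inner_self_eq (A := A) (hin a a).symm
  let gc : LinearMap.range Φ →L[Aᵐᵒᵖ] N :=
    ⟨g, (AddMonoidHomClass.isometry_of_norm g hgn).continuous⟩
  let e : LinearMap.range Φ →L[Aᵐᵒᵖ] M := (LinearMap.range Φ).subtypeL
  have hd : DenseRange e := by
    have : Set.range e = (Submodule.span Aᵐᵒᵖ (Set.range m) : Set M) := by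
      rw [← Finsupp.range_linearCombination]
      exact Subtype.range_coe
    rw [DenseRange, this]
    exact hm
  have he : IsUniformInducing e := isUniformEmbedding_subtype_val.isUniformInducing
  let W : M →L[Aᵐᵒᵖ] N := gc.extend e
  have hW : ∀ x, W (e x) = gc x := gc.extend_eq hd he
  have hWin : ∀ x y, ⟪W x, W y⟫_A = ⟪x, y⟫_A := fun x y => by
    refine hd.induction_on₂ (p := fun x y => ⟪W x, W y⟫_A = ⟪x, y⟫_A) ?_ ?_ x y
    · exact isClosed_eq (continuous_inner_comp (W.continuous.comp continuous_fst)
        (W.continuous.comp continuous_snd)) continuous_inner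
    · rintro ⟨_, a, rfl⟩ ⟨_, b, rfl⟩
      rw [hW, hW]
      exact (congrArg₂ (fun u v => ⟪u, v⟫_A) (hg a) (hg b)).trans (hin a b).symm
  refine ⟨⟨W.toLinearMap, fun x => norm_eq_of_inner_self_eq (A := A) (hWin x x)⟩, fun i => ?_, hWin⟩
  have h1 : Φ (Finsupp.single i 1) = m i := by simp [Φ]
  have h2 : Ψ (Finsupp.single i 1) = n i := by simp [Ψ]
  have h3 := (hW ⟨_, Finsupp.single i 1, rfl⟩).trans (hg (Finsupp.single i 1))
  rw [h2] at h3
  rw [← h3, ← h1]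
  rfl

/-- An isometry of Hilbert modules has an adjoint as soon as it has one on a dense set. -/
theorem exists_adjoint [CompleteSpace M] (W : M → N) (hW : ∀ x y, ⟪W x, W y⟫_A = ⟪x, y⟫_A)
    {s : Set N} (hs : Dense s) (h : ∀ y ∈ s, ∃ x, ∀ z, ⟪z, x⟫_A = ⟪W z, y⟫_A) :
    ∃ V : N →L[ℂ] M, ∀ z y, ⟪z, V y⟫_A = ⟪W z, y⟫_A := by
  have hle : ∀ {x : M} {y : N}, (∀ z, ⟪z, x⟫_A = ⟪W z, y⟫_A) → ‖x‖ ≤ ‖y‖ := fun {x y} hxy =>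
    norm_le_of_inner_eq (A := A) (hxy x) (norm_eq_of_inner_self_eq (A := A) (hW x x))
  have hall : ∀ y, ∃ x, ∀ z, ⟪z, x⟫_A = ⟪W z, y⟫_A := fun y => by
    obtain ⟨u, hus, hu⟩ := mem_closure_iff_seq_limit.mp (hs y)
    choose x hx using fun n => h (u n) (hus n)
    have hc : CauchySeq x := by
      refine Metric.cauchySeq_iff.mpr fun ε hε => ?_
      obtain ⟨n₀, hn₀⟩ := Metric.cauchySeq_iff.mp hu.cauchySeq ε hε
      refine ⟨n₀, fun p hp q hq => (hn₀ p hp q hq).trans_le' ?_⟩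
      rw [dist_eq_norm, dist_eq_norm]
      exact hle fun z => by rw [inner_sub_right, inner_sub_right, hx, hx]
    obtain ⟨x₀, hx₀⟩ := cauchySeq_tendsto_of_complete hc
    refine ⟨x₀, fun z => tendsto_nhds_unique
      (((innerCLM A z).continuous.tendsto x₀).comp hx₀) ?_⟩
    refine (((innerCLM A (W z)).continuous.tendsto y).comp hu).congr fun n => ?_
    exact (hx n z).symm
  choose V hV using hall
  refine ⟨LinearMap.mkContinuous
    { toFun := V
      map_add' := fun y y' => ext_inner (A := A) fun z => by
        rw [hV, inner_add_right, inner_add_right, hV, hV]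
      map_smul' := fun c y => ext_inner (A := A) fun z => by
        rw [hV, RingHom.id_apply, inner_smul_right, inner_smul_right, hV] } 1 fun y => ?_,
    fun z y => hV y z⟩
  rw [one_mul]
  exact hle (hV y)

end Lift

end InnerCStarModule

end HilbertModuleLemmas

section SquareIntegrableLemmas

open Filter Topology

variable {X : Type*} [MeasurableSpace X] {μ : Measure X}

theorem exists_measurableSet_norm_le [IsFiniteMeasure μ] {F : Type*} [NormedAddCommGroup F]
    {f : X → F} (hf : AEStronglyMeasurable f μ) :
    ∃ s : ℕ → Set X, (∀ n, MeasurableSet (s n)) ∧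
      (∀ n, ∀ᵐ x ∂μ, x ∈ s n → ‖f x‖ ≤ n) ∧ (∀ x, ∀ᶠ n in atTop, x ∈ s n) ∧
      Tendsto (fun n => μ (s n)ᶜ) atTop (𝓝 0) := by
  let g := hf.mk f
  have hg : Measurable fun x => ‖g x‖ := hf.stronglyMeasurable_mk.norm.measurable
  have hs : ∀ n : ℕ, MeasurableSet {x | ‖g x‖ ≤ n} := fun n => measurableSet_le hg measurable_const
  refine ⟨fun n => {x | ‖g x‖ ≤ n}, hs, fun n => ?_, fun x => ?_, ?_⟩
  · filter_upwards [hf.ae_eq_mk] with x hx hn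
    rw [hx]; exact hn
  · obtain ⟨n, hn⟩ := exists_nat_ge ‖g x‖
    filter_upwards [eventually_ge_atTop n] with k hk
    exact hn.trans (by exact_mod_cast hk)
  · have h := tendsto_measure_iInter_atTop (μ := μ) (s := fun n : ℕ => {x | ‖g x‖ ≤ n}ᶜ)
      (fun n => (hs n).compl.nullMeasurableSet)
      (fun m n hmn => Set.compl_subset_compl.mpr fun x hx =>
        le_trans (α := ℝ) hx (by exact_mod_cast hmn)) ⟨0, measure_ne_top _ _⟩
    have h0 : ⋂ n : ℕ, {x | ‖g x‖ ≤ n}ᶜ = ∅ := by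
      rw [← Set.compl_iUnion, Set.compl_empty_iff, Set.iUnion_eq_univ_iff]
      exact fun x => exists_nat_ge ‖g x‖
    rwa [h0, measure_empty] at h

theorem memLp_indicator_of_bound [IsFiniteMeasure μ] {F : Type*} [NormedAddCommGroup F]
    {f : X → F} (hf : AEStronglyMeasurable f μ) {s : Set X} (hs : MeasurableSet s) {C : ℝ}
    (hC : ∀ᵐ x ∂μ, x ∈ s → ‖f x‖ ≤ C) : MemLp (s.indicator f) 2 μ := by
  refine MemLp.of_bound (hf.indicator hs) (max C 0) ?_
  filter_upwards [hC] with x hx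
  by_cases h : x ∈ s
  · rw [Set.indicator_of_mem h]; exact (hx h).trans (le_max_left _ _)
  · rw [Set.indicator_of_notMem h, norm_zero]; exact le_max_right _ _

variable {D : Type*} [CStarAlgebra D] [PartialOrder D] [StarOrderedRing D]

theorem PositiveLinearMap.norm_apply_star_mul_le (φ : D →ₚ[ℂ] ℂ) (a b : D) :
    ‖φ (star a * b)‖ ≤ (φ (star a * a)).re + (φ (star b * b)).re := by
  have hsq : ∀ c : D, ‖φ.toPreGNS c‖ ^ 2 = (φ (star c * c)).re := fun c => by
    have h := φ.preGNS_norm_sq (φ.toPreGNS c)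
    rw [PositiveLinearMap.ofPreGNS_toPreGNS] at h
    rw [← h, ← Complex.ofReal_pow, Complex.ofReal_re]
  have h := norm_inner_le_norm (𝕜 := ℂ) (φ.toPreGNS a) (φ.toPreGNS b)
  rw [PositiveLinearMap.preGNS_inner_def, PositiveLinearMap.ofPreGNS_toPreGNS,
    PositiveLinearMap.ofPreGNS_toPreGNS] at h
  rw [← hsq, ← hsq]
  nlinarith [sq_nonneg (‖φ.toPreGNS a‖ - ‖φ.toPreGNS b‖), sq_nonneg ‖φ.toPreGNS a‖,
    sq_nonneg ‖φ.toPreGNS b‖]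

theorem PositiveLinearMap.continuous_functional (φ : D →ₚ[ℂ] ℂ) : Continuous φ :=
  map_continuous φ

namespace L2Module

theorem of_zero : of (0 : X → D) (MemLp.zero (μ := μ)) = 0 := Completion.coe_zero

theorem of_add {f g : X → D} (hf : MemLp f 2 μ) (hg : MemLp g 2 μ) :
    of (f + g) (hf.add hg) = of f hf + of g hg :=
  Completion.coe_add (Pre.mk f hf) (Pre.mk g hg)

theorem of_sub {f g : X → D} (hf : MemLp f 2 μ) (hg : MemLp g 2 μ) :
    of (f - g) (hf.sub hg) = of f hf - of g hg :=
  Completion.coe_sub (Pre.mk f hf) (Pre.mk g hg)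

theorem of_op_smul (a : D) {f : X → D} (hf : MemLp f 2 μ)
    (hfa : MemLp (fun x => f x * a) 2 μ) : of (fun x => f x * a) hfa = of f hf <• a :=
  InnerCStarModule.completion_op_smul_coe a (Pre.mk f hf)

theorem norm_of_sq_le {f : X → D} (hf : MemLp f 2 μ) : ‖of f hf‖ ^ 2 ≤ ∫ x, ‖f x‖ ^ 2 ∂μ := by
  rw [InnerCStarModule.norm_sq_eq (A := D), inner_of]
  refine (norm_integral_le_integral_norm _).trans_eq (integral_congr_ae (.of_forall fun x => ?_))
  simp only [CStarRing.norm_star_mul_self, sq]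

theorem of_congr {f g : X → D} (hf : MemLp f 2 μ) (hg : MemLp g 2 μ) (hfg : f =ᵐ[μ] g) :
    of f hf = of g hg := by
  have h := norm_of_sq_le (hf.sub hg)
  rw [integral_eq_zero_of_ae, of_sub hf hg] at h
  · rw [← sub_eq_zero, ← norm_eq_zero, ← sq_eq_zero_iff]
    exact le_antisymm h (sq_nonneg _)
  · filter_upwards [hfg] with x hx
    simp [hx]

theorem norm_of_sq_le_of_bound [IsFiniteMeasure μ] {f : X → D} (hf : MemLp f 2 μ) {C : ℝ}
    (hC : ∀ᵐ x ∂μ, ‖f x‖ ≤ C) : ‖of f hf‖ ^ 2 ≤ C ^ 2 * μ.real Set.univ := by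
  refine (norm_of_sq_le hf).trans ?_
  have h : ∫ x, ‖f x‖ ^ 2 ∂μ ≤ ∫ _, C ^ 2 ∂μ := by
    refine integral_mono_ae ((memLp_two_iff_integrable_sq_norm hf.aestronglyMeasurable).mp hf) (integrable_const _) ?_
    filter_upwards [hC] with x hx
    exact pow_le_pow_left₀ (norm_nonneg _) hx 2
  rwa [integral_const, smul_eq_mul, mul_comm] at h

theorem induction_on {p : L2Module μ D → Prop} (η : L2Module μ D) (hp : IsClosed {η | p η})
    (h : ∀ f hf, p (of f hf)) : p η :=
  Completion.induction_on η hp fun f => h f.fn f.memLp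

theorem induction_on₂ {p : L2Module μ D → L2Module μ D → Prop} (η ζ : L2Module μ D)
    (hp : IsClosed {x : L2Module μ D × L2Module μ D | p x.1 x.2})
    (h : ∀ f hf g hg, p (of f hf) (of g hg)) : p η ζ :=
  Completion.induction_on₂ η ζ hp fun f g => h f.fn f.memLp g.fn g.memLp

variable (μ D) in
theorem dense_range_of : Dense {η : L2Module μ D | ∃ f hf, η = of f hf} := fun η =>
  induction_on η isClosed_closure fun f hf => subset_closure ⟨f, hf, rfl⟩

theorem inner_indicatorMul {Δ : Set X} (hΔ : MeasurableSet Δ) (η ζ : L2Module μ D) :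
    ⟪indicatorMul μ D Δ hΔ η, ζ⟫_D = ⟪η, indicatorMul μ D Δ hΔ ζ⟫_D := by
  refine induction_on₂ (p := fun η ζ => ⟪indicatorMul μ D Δ hΔ η, ζ⟫_D =
    ⟪η, indicatorMul μ D Δ hΔ ζ⟫_D) η ζ ?_ fun f hf g hg => ?_
  · exact isClosed_eq (InnerCStarModule.continuous_inner_comp (by fun_prop) (by fun_prop))
      (InnerCStarModule.continuous_inner_comp (by fun_prop) (by fun_prop))
  · rw [indicatorMul_of, indicatorMul_of, inner_of, inner_of]
    congr 1
    ext x
    by_cases hx : x ∈ Δ <;> simp [hx]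

theorem indicatorMul_inter {Δ Δ' : Set X} (hΔ : MeasurableSet Δ) (hΔ' : MeasurableSet Δ')
    (h : MeasurableSet (Δ ∩ Δ')) (η : L2Module μ D) :
    indicatorMul μ D (Δ ∩ Δ') h η = indicatorMul μ D Δ hΔ (indicatorMul μ D Δ' hΔ' η) := by
  refine induction_on (p := fun η => indicatorMul μ D (Δ ∩ Δ') h η =
    indicatorMul μ D Δ hΔ (indicatorMul μ D Δ' hΔ' η)) η
    (isClosed_eq (by fun_prop) (by fun_prop)) fun f hf => ?_
  rw [indicatorMul_of, indicatorMul_of, indicatorMul_of]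
  congr 1
  exact (Set.indicator_indicator Δ Δ' f).symm

theorem indicatorMul_idem {Δ : Set X} (hΔ : MeasurableSet Δ) (η : L2Module μ D) :
    indicatorMul μ D Δ hΔ (indicatorMul μ D Δ hΔ η) = indicatorMul μ D Δ hΔ η := by
  rw [← indicatorMul_inter hΔ hΔ (hΔ.inter hΔ)]
  simp only [Set.inter_self]

theorem indicatorMul_univ (η : L2Module μ D) :
    indicatorMul μ D Set.univ MeasurableSet.univ η = η := by
  refine induction_on (p := fun η => indicatorMul μ D Set.univ MeasurableSet.univ η = η) η
    (isClosed_eq (by fun_prop) (by fun_prop)) fun f hf => ?_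
  rw [indicatorMul_of]
  congr 1
  exact Set.indicator_univ f

theorem indicatorMul_union {Δ Δ' : Set X} (hΔ : MeasurableSet Δ) (hΔ' : MeasurableSet Δ')
    (hd : Disjoint Δ Δ') (h : MeasurableSet (Δ ∪ Δ')) (η : L2Module μ D) :
    indicatorMul μ D (Δ ∪ Δ') h η = indicatorMul μ D Δ hΔ η + indicatorMul μ D Δ' hΔ' η := by
  refine induction_on (p := fun η => indicatorMul μ D (Δ ∪ Δ') h η =
    indicatorMul μ D Δ hΔ η + indicatorMul μ D Δ' hΔ' η) η
    (isClosed_eq (by fun_prop) (by fun_prop)) fun f hf => ?_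
  rw [indicatorMul_of, indicatorMul_of, indicatorMul_of, ← of_add]
  congr 1
  exact Set.indicator_union_of_disjoint hd f

theorem norm_indicatorMul_le {Δ : Set X} (hΔ : MeasurableSet Δ) (η : L2Module μ D) :
    ‖indicatorMul μ D Δ hΔ η‖ ≤ ‖η‖ :=
  InnerCStarModule.norm_le_of_inner_eq (A := D) (y := indicatorMul μ D Δ hΔ η)
    (by rw [← inner_indicatorMul, indicatorMul_idem]) rfl

theorem tendsto_indicatorMul_zero {ι : Type*} {l : Filter ι} {s : ι → Set X}
    (hs : ∀ i, MeasurableSet (s i)) (hl : Tendsto (fun i => μ (s i)) l (𝓝 0)) (η : L2Module μ D) :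
    Tendsto (fun i => indicatorMul μ D (s i) (hs i) η) l (𝓝 0) := by
  have hof : ∀ f (hf : MemLp f 2 μ),
      Tendsto (fun i => indicatorMul μ D (s i) (hs i) (of f hf)) l (𝓝 0) := fun f hf => by
    have h1 := ((memLp_two_iff_integrable_sq_norm hf.aestronglyMeasurable).mp hf).tendsto_setIntegral_nhds_zero hl
    rw [tendsto_zero_iff_norm_tendsto_zero]
    have h2 : Tendsto (fun i => ‖indicatorMul μ D (s i) (hs i) (of f hf)‖ ^ 2) l (𝓝 0) := by
      refine squeeze_zero (fun i => sq_nonneg _) (fun i => ?_) h1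
      rw [indicatorMul_of]
      refine (norm_of_sq_le _).trans_eq ?_
      rw [← integral_indicator (hs i)]
      congr 1
      ext x
      by_cases hx : x ∈ s i <;> simp [hx]
    have h3 := (Real.continuous_sqrt.tendsto 0).comp h2
    rw [Real.sqrt_zero] at h3
    exact h3.congr fun i => Real.sqrt_sq (norm_nonneg _)
  rw [Metric.tendsto_nhds]
  intro ε hε
  obtain ⟨_, ⟨f, hf, rfl⟩, hd⟩ := (dense_range_of μ D).exists_dist_lt η (half_pos hε)
  filter_upwards [Metric.tendsto_nhds.mp (hof f hf) (ε / 2) (half_pos hε)] with i hi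
  rw [dist_zero_right] at hi ⊢
  rw [dist_eq_norm] at hd
  have h1 := (norm_indicatorMul_le (hs i) (η - of f hf)).trans_lt hd
  have h2 : indicatorMul μ D (s i) (hs i) η =
      indicatorMul μ D (s i) (hs i) (η - of f hf) + indicatorMul μ D (s i) (hs i) (of f hf) := by
    rw [map_sub, sub_add_cancel]
  rw [h2]
  linarith [norm_add_le (indicatorMul μ D (s i) (hs i) (η - of f hf))
    (indicatorMul μ D (s i) (hs i) (of f hf))]

theorem indicatorMul_add_compl {Δ : Set X} (hΔ : MeasurableSet Δ) (η : L2Module μ D) :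
    indicatorMul μ D Δ hΔ η + indicatorMul μ D Δᶜ hΔ.compl η = η := by
  rw [← indicatorMul_union hΔ hΔ.compl disjoint_compl_right (hΔ.union hΔ.compl)]
  simp only [Set.union_compl_self, indicatorMul_univ]

theorem tendsto_indicatorMul {ι : Type*} {l : Filter ι} {s : ι → Set X}
    (hs : ∀ i, MeasurableSet (s i)) (hl : Tendsto (fun i => μ (s i)ᶜ) l (𝓝 0))
    (η : L2Module μ D) : Tendsto (fun i => indicatorMul μ D (s i) (hs i) η) l (𝓝 η) := by
  have h := tendsto_const_nhds (x := η) |>.sub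
    (tendsto_indicatorMul_zero (fun i => (hs i).compl) hl η)
  rw [sub_zero] at h
  exact h.congr fun i => sub_eq_of_eq_add (indicatorMul_add_compl (hs i) η).symm

theorem hasSum_indicatorMul [IsFiniteMeasure μ] {s : ℕ → Set X} (hs : ∀ n, MeasurableSet (s n))
    (hd : Pairwise (Function.onFun Disjoint s)) (η : L2Module μ D) :
    HasSum (fun n => indicatorMul μ D (s n) (hs n) η)
      (indicatorMul μ D (⋃ n, s n) (MeasurableSet.iUnion hs) η) := by
  let t : Finset ℕ → Set X := fun F => ⋃ n : {n // n ∉ F}, s n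
  have ht : ∀ F, MeasurableSet (t F) := fun F => MeasurableSet.iUnion fun n => hs n
  have hsum : ∀ F : Finset ℕ, ∑ n ∈ F, indicatorMul μ D (s n) (hs n) η +
      indicatorMul μ D (t F) (ht F) η =
        indicatorMul μ D (⋃ n, s n) (MeasurableSet.iUnion hs) η := fun F => by
    induction F using Finset.induction_on with
    | empty =>
      have h0 : t ∅ = ⋃ n, s n := by ext x; simp [t]
      simp only [Finset.sum_empty, zero_add, h0]
    | insert a F ha ih =>
      have h1 : t F = s a ∪ t (insert a F) := by
        ext x
        simp only [t, Set.mem_iUnion, Set.mem_union, Finset.mem_insert, Subtype.exists,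
          exists_prop]
        constructor
        · rintro ⟨n, hn, hx⟩
          by_cases hna : n = a
          · exact Or.inl (hna ▸ hx)
          · exact Or.inr ⟨n, by tauto, hx⟩
        · rintro (hx | ⟨n, hn, hx⟩)
          · exact ⟨a, ha, hx⟩
          · exact ⟨n, by tauto, hx⟩
      have h2 : Disjoint (s a) (t (insert a F)) := by
        refine Set.disjoint_iUnion_right.mpr fun n => hd fun h => n.2 ?_
        exact Finset.mem_insert.mpr (Or.inl h.symm)
      rw [Finset.sum_insert ha, ← ih]
      simp only [h1, indicatorMul_union (hs a) (ht (insert a F)) h2]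
      abel
  have hμ : Tendsto (fun F => μ (t F)) atTop (𝓝 0) := by
    have h1 : ∑' n, μ (s n) ≠ ∞ := by
      rw [← measure_iUnion hd hs]; exact measure_ne_top _ _
    exact tendsto_of_tendsto_of_tendsto_of_le_of_le tendsto_const_nhds
      (ENNReal.tendsto_tsum_compl_atTop_zero h1) (fun _ => zero_le)
      fun F => measure_iUnion_le _
  have h := tendsto_const_nhds
    (x := indicatorMul μ D (⋃ n, s n) (MeasurableSet.iUnion hs) η) |>.sub
    (tendsto_indicatorMul_zero ht hμ η)
  rw [sub_zero] at h
  exact h.congr fun F => sub_eq_of_eq_add (hsum F).symm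

variable (μ D) in
theorem isPVMeasure_indicatorMul [IsFiniteMeasure μ] : IsPVMeasure D (indicatorMul μ D) where
  selfAdjoint Δ hΔ x y := inner_indicatorMul hΔ x y
  nonneg Δ hΔ x := by
    rw [← indicatorMul_idem, ← inner_indicatorMul]
    exact InnerCStarModule.inner_self_nonneg _
  univ := ContinuousLinearMap.ext indicatorMul_univ
  hasSum s hs hd x := hasSum_indicatorMul hs hd x
  inter Δ Δ' hΔ hΔ' := ContinuousLinearMap.ext (indicatorMul_inter hΔ hΔ' (hΔ.inter hΔ'))

theorem represents_of {f : X → D} (hf : MemLp f 2 μ) : (of f hf).Represents f :=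
  ⟨hf.aestronglyMeasurable, fun _ hΔ _ => indicatorMul_of hΔ hf⟩

theorem Represents.unique [IsFiniteMeasure μ] {η ζ : L2Module μ D} {u : X → D}
    (hη : η.Represents u) (hζ : ζ.Represents u) : η = ζ := by
  obtain ⟨s, hs, hb, -, hμ⟩ := exists_measurableSet_norm_le hη.1
  refine tendsto_nhds_unique (tendsto_indicatorMul hs hμ η)
    ((tendsto_indicatorMul hs hμ ζ).congr fun n => ?_)
  have hm := memLp_indicator_of_bound hη.1 (hs n) (hb n)
  rw [hη.2 _ (hs n) hm, hζ.2 _ (hs n) hm]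

/-- If square integrable functions converge in the Hilbert module and almost everywhere, then the
limits agree. -/
theorem represents_of_tendsto [IsFiniteMeasure μ] {u : ℕ → X → D} {v : X → D} {η : L2Module μ D}
    (hu : ∀ n, MemLp (u n) 2 μ) (hη : Tendsto (fun n => of (u n) (hu n)) atTop (𝓝 η))
    (huv : ∀ᵐ x ∂μ, Tendsto (fun n => u n x) atTop (𝓝 (v x))) : η.Represents v := by
  have hv : AEStronglyMeasurable v μ :=
    aestronglyMeasurable_of_tendsto_ae atTop (fun n => (hu n).aestronglyMeasurable) huv
  refine ⟨hv, fun Δ hΔ hm => ?_⟩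
  have hmk : ∀ᵐ x ∂μ, ∀ n, u n x = (hu n).aestronglyMeasurable.mk (u n) x :=
    ae_all_iff.mpr fun n => (hu n).aestronglyMeasurable.ae_eq_mk
  have hE : ∀ k : ℕ, ∃ t, MeasurableSet t ∧ μ t ≤ ENNReal.ofReal (1 / ((k : ℝ) + 1)) ∧
      TendstoUniformlyOn (fun n => (hu n).aestronglyMeasurable.mk (u n)) (hv.mk v) atTop tᶜ :=
    fun k => by
      refine tendstoUniformlyOn_of_ae_tendsto'
        (fun n => (hu n).aestronglyMeasurable.stronglyMeasurable_mk) hv.stronglyMeasurable_mk ?_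
        (by positivity)
      filter_upwards [huv, hmk, hv.ae_eq_mk] with x h1 h2 h3
      rw [← h3]
      exact h1.congr h2
  choose t ht hμt hut using hE
  have hμ : Tendsto (fun k => μ (t k)ᶜᶜ) atTop (𝓝 0) := by
    simp only [compl_compl]
    refine tendsto_of_tendsto_of_tendsto_of_le_of_le tendsto_const_nhds ?_
      (fun _ => zero_le) hμt
    have := (ENNReal.continuous_ofReal.tendsto 0).comp tendsto_one_div_add_atTop_nhds_zero_nat
    rwa [ENNReal.ofReal_zero] at this
  refine tendsto_nhds_unique (tendsto_indicatorMul (fun k => (ht k).compl) hμ _)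
    ((tendsto_indicatorMul (fun k => (ht k).compl) hμ _).congr fun k => ?_)
  let P := indicatorMul μ D (t k)ᶜ (ht k).compl
  have h1 : Tendsto (fun n => P (indicatorMul μ D Δ hΔ (of (u n) (hu n)))) atTop
      (𝓝 (P (indicatorMul μ D Δ hΔ η))) :=
    ((P.continuous.comp (indicatorMul μ D Δ hΔ).continuous).tendsto η).comp hη
  refine tendsto_nhds_unique ?_ h1
  rw [tendsto_iff_norm_sub_tendsto_zero]
  have h2 : Tendsto (fun n => ‖P (indicatorMul μ D Δ hΔ (of (u n) (hu n))) -
      P (of (Δ.indicator v) hm)‖ ^ 2) atTop (𝓝 0) := by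
    rw [Metric.tendsto_nhds]
    intro ε hε
    set c := μ.real Set.univ with hc
    have hc0 : 0 ≤ c := measureReal_nonneg
    let δ := √(ε / (c + 1))
    have hδ : 0 < δ := Real.sqrt_pos.mpr (by positivity)
    have hδ2 : δ ^ 2 * c < ε := by
      rw [Real.sq_sqrt (by positivity), div_mul_eq_mul_div, div_lt_iff₀ (by positivity)]
      nlinarith
    filter_upwards [Metric.tendstoUniformlyOn_iff.mp (hut k) δ hδ] with n hn
    rw [Real.dist_eq, sub_zero, abs_of_nonneg (sq_nonneg _)]
    refine lt_of_le_of_lt ?_ hδ2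
    rw [indicatorMul_of, ← map_sub, ← of_sub, indicatorMul_of]
    refine norm_of_sq_le_of_bound _ ?_
    filter_upwards [hmk, hv.ae_eq_mk] with x hx1 hx2
    by_cases hxt : x ∈ (t k)ᶜ
    · rw [Set.indicator_of_mem hxt, Pi.sub_apply]
      by_cases hxΔ : x ∈ Δ
      · rw [Set.indicator_of_mem hxΔ, Set.indicator_of_mem hxΔ, hx1 n, hx2, ← dist_eq_norm,
          dist_comm]
        exact (hn x hxt).le
      · rw [Set.indicator_of_notMem hxΔ, Set.indicator_of_notMem hxΔ, sub_zero, norm_zero]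
        exact hδ.le
    · rw [Set.indicator_of_notMem hxt, norm_zero]
      exact hδ.le
  have h3 := (Real.continuous_sqrt.tendsto 0).comp h2
  rw [Real.sqrt_zero] at h3
  exact h3.congr fun i => Real.sqrt_sq (norm_nonneg _)

theorem Represents.hasWeakIntegral_of_memLp {η ζ : L2Module μ D} {u v : X → D}
    (hη : η.Represents u) (hζ : ζ.Represents v) {Δ : Set X} (hΔ : MeasurableSet Δ)
    (hu : MemLp (Δ.indicator u) 2 μ) (hv : MemLp (Δ.indicator v) 2 μ) :
    HasWeakIntegral (μ.restrict Δ) (fun x => star (u x) * v x)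
      ⟪η, indicatorMul μ D Δ hΔ ζ⟫_D := fun φ => by
  have heq : (fun x => star (Δ.indicator u x) * Δ.indicator v x) =
      Δ.indicator fun x => star (u x) * v x := by
    ext x
    by_cases hx : x ∈ Δ <;> simp [hx]
  have hint := integrable_star_mul hu hv
  rw [heq, integrable_indicator_iff hΔ] at hint
  let φ' : D →L[ℂ] ℂ := ⟨φ.toLinearMap, φ.continuous_functional⟩
  refine ⟨φ'.integrable_comp hint, ?_⟩
  rw [← indicatorMul_idem, ← inner_indicatorMul, hη.2 Δ hΔ hu, hζ.2 Δ hΔ hv, inner_of, heq,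
    integral_indicator hΔ]
  exact φ'.integral_comp_comm hint

theorem Represents.hasWeakIntegral [IsFiniteMeasure μ] {η ζ : L2Module μ D} {u v : X → D}
    (hη : η.Represents u) (hζ : ζ.Represents v) {Δ : Set X} (hΔ : MeasurableSet Δ) :
    HasWeakIntegral (μ.restrict Δ) (fun x => star (u x) * v x)
      ⟪η, indicatorMul μ D Δ hΔ ζ⟫_D := fun φ => by
  have hlim : ∀ {s : ℕ → Set X} (hs : ∀ n, MeasurableSet (s n)),
      Tendsto (fun n => μ (s n)ᶜ) atTop (𝓝 0) → ∀ η ζ : L2Module μ D,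
      Tendsto (fun n => φ ⟪η, indicatorMul μ D (s n) (hs n) ζ⟫_D) atTop (𝓝 (φ ⟪η, ζ⟫_D)) :=
    fun hs hμ η ζ => (φ.continuous_functional.tendsto _).comp
      (((InnerCStarModule.innerCLM D η).continuous.tendsto ζ).comp (tendsto_indicatorMul hs hμ ζ))
  have hself : ∀ {η : L2Module μ D} {u : X → D}, η.Represents u →
      Integrable (fun x => (φ (star (u x) * u x)).re) μ := fun {η u} hη => by
    obtain ⟨s, hs, hb, hmem, hμ⟩ := exists_measurableSet_norm_le hη.1
    have hcov : AECover μ atTop s := ⟨.of_forall hmem, hs⟩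
    have hw := fun n => hη.hasWeakIntegral_of_memLp hη (hs n)
      (memLp_indicator_of_bound hη.1 (hs n) (hb n)) (memLp_indicator_of_bound hη.1 (hs n) (hb n)) φ
    refine hcov.integrable_of_integral_tendsto_of_nonneg_ae (φ ⟪η, η⟫_D).re
      (fun n => (hw n).1.re) (.of_forall fun x => ?_) ?_
    · exact (Complex.nonneg_iff.mp (map_nonneg φ (star_mul_self_nonneg (u x)))).1
    · refine ((Complex.continuous_re.tendsto _).comp (hlim hs hμ η η)).congr fun n => ?_
      rw [Function.comp_apply, ← (hw n).2]
      exact (Complex.reCLM.integral_comp_comm (hw n).1).symm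
  have hint : Integrable (fun x => φ (star (u x) * v x)) μ := by
    refine ((hself hη).add (hself hζ)).mono'
      (φ.continuous_functional.comp_aestronglyMeasurable (hη.1.star.mul hζ.1))
      (.of_forall fun x => φ.norm_apply_star_mul_le _ _)
  refine ⟨hint.restrict, ?_⟩
  obtain ⟨s, hs, hb, hmem, hμ⟩ := exists_measurableSet_norm_le (hη.1.prodMk hζ.1)
  have hcov : AECover (μ.restrict Δ) atTop s := ⟨.of_forall hmem, hs⟩
  refine tendsto_nhds_unique (hcov.integral_tendsto_of_countably_generated hint.restrict)
    ((hlim hs hμ η (indicatorMul μ D Δ hΔ ζ)).congr fun n => ?_)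
  have h1 : ∀ᵐ x ∂μ, x ∈ s n ∩ Δ → ‖u x‖ ≤ n := by
    filter_upwards [hb n] with x hx h using (norm_fst_le (u x, v x)).trans (hx h.1)
  have h2 : ∀ᵐ x ∂μ, x ∈ s n ∩ Δ → ‖v x‖ ≤ n := by
    filter_upwards [hb n] with x hx h using (norm_snd_le (u x, v x)).trans (hx h.1)
  have hw := hη.hasWeakIntegral_of_memLp hζ ((hs n).inter hΔ)
    (memLp_indicator_of_bound hη.1 ((hs n).inter hΔ) h1)
    (memLp_indicator_of_bound hζ.1 ((hs n).inter hΔ) h2) φ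
  rw [Measure.restrict_restrict (hs n), hw.2, indicatorMul_inter (hs n) hΔ]

theorem Represents.hasWeakIntegral_univ [IsFiniteMeasure μ] {η ζ : L2Module μ D} {u v : X → D}
    (hη : η.Represents u) (hζ : ζ.Represents v) :
    HasWeakIntegral μ (fun x => star (u x) * v x) ⟪η, ζ⟫_D := by
  have h := hη.hasWeakIntegral hζ MeasurableSet.univ
  rwa [Measure.restrict_univ, indicatorMul_univ] at h

end L2Module

end SquareIntegrableLemmas

section AnalysisOperator

open Filter Topology InnerCStarModule

variable {X D H : Type*} [MeasurableSpace X] {μ : Measure X}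
  [CStarAlgebra D] [PartialOrder D] [StarOrderedRing D]

theorem L2Module.norm_of_le {f : X → D} (hf : MemLp f 2 μ) :
    ‖L2Module.of f hf‖ ≤ (eLpNorm f 2 μ).toReal := by
  have h0 : 0 ≤ ∫ x, ‖f x‖ ^ 2 ∂μ := integral_nonneg fun x => sq_nonneg _
  have h1 := hf.eLpNorm_eq_integral_rpow_norm two_ne_zero ENNReal.ofNat_ne_top
  simp only [ENNReal.toReal_ofNat, Real.rpow_ofNat] at h1
  rw [h1, ENNReal.toReal_ofReal (Real.rpow_nonneg h0 _), ← one_div, ← Real.sqrt_eq_rpow]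
  exact Real.le_sqrt_of_sq_le (L2Module.norm_of_sq_le hf)

theorem HasWeakIntegral.unique {f : X → D} {a b : D}
    (hsep : ∀ a b : D, (∀ φ : D →ₚ[ℂ] ℂ, φ a = φ b) → a = b)
    (ha : HasWeakIntegral μ f a) (hb : HasWeakIntegral μ f b) : a = b :=
  hsep a b fun φ => (ha φ).2.symm.trans (hb φ).2

theorem hasWeakIntegral_integral {f : X → D} (hf : Integrable f μ) :
    HasWeakIntegral μ f (∫ x, f x ∂μ) := fun φ =>
  let φ' : D →L[ℂ] ℂ := ⟨φ.toLinearMap, φ.continuous_functional⟩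
  ⟨φ'.integrable_comp hf, φ'.integral_comp_comm hf⟩

theorem IsKernelOperator.unique [IsFiniteMeasure μ] {K : X → X → D}
    {P Q : L2Module μ D →L[ℂ] L2Module μ D}
    (hsep : ∀ a b : D, (∀ φ : D →ₚ[ℂ] ℂ, φ a = φ b) → a = b)
    (hP : IsKernelOperator μ K P) (hQ : IsKernelOperator μ K Q) : P = Q := by
  refine ContinuousLinearMap.ext fun η => L2Module.induction_on (p := fun η => P η = Q η) η
    (isClosed_eq P.continuous Q.continuous) fun h hh => ?_
  obtain ⟨v, hv, hPv⟩ := hP h hh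
  obtain ⟨w, hw, hQw⟩ := hQ h hh
  obtain rfl : v = w := funext fun x => (hv x).unique hsep (hw x)
  exact hPv.unique hQw

theorem IsIntegralOfKetBra.unique {M : Type*} [NormedAddCommGroup M] [NormedSpace ℂ M]
    [Module Dᵐᵒᵖ M] [InnerCStarModule D M] {h : X → M}
    {ν ν' : ∀ Δ : Set X, MeasurableSet Δ → M →L[ℂ] M}
    (hsep : ∀ a b : D, (∀ φ : D →ₚ[ℂ] ℂ, φ a = φ b) → a = b)
    (hν : IsIntegralOfKetBra D μ h ν) (hν' : IsIntegralOfKetBra D μ h ν') : ν = ν' := by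
  ext Δ hΔ g
  exact ext_inner (A := D) fun f => (hν Δ hΔ f g).unique hsep (hν' Δ hΔ f g)

variable [NormedAddCommGroup H] [NormedSpace ℂ H] [Module Dᵐᵒᵖ H] [InnerCStarModule D H]

theorem norm_indicator_inner_le {Δ : Set X} {C : ℝ} (k ψ : X → H) {x : X}
    (hx : x ∈ Δ → ‖k x‖ ≤ C) :
    ‖Δ.indicator (fun x => ⟪k x, ψ x⟫_D) x‖ ≤ max C 0 * ‖ψ x‖ := by
  by_cases h : x ∈ Δ
  · rw [Set.indicator_of_mem h]
    exact (norm_inner_le _ _).trans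
      (mul_le_mul_of_nonneg_right ((hx h).trans (le_max_left _ _)) (norm_nonneg _))
  · rw [Set.indicator_of_notMem h, norm_zero]
    positivity

theorem memLp_indicator_inner {k : X → H} (hk : AEStronglyMeasurable k μ) {Δ : Set X}
    (hΔ : MeasurableSet Δ) {C : ℝ} (hC : ∀ᵐ x ∂μ, x ∈ Δ → ‖k x‖ ≤ C) {ψ : X → H}
    (hψ : MemLp ψ 2 μ) : MemLp (Δ.indicator fun x => ⟪k x, ψ x⟫_D) 2 μ := by
  refine hψ.of_le_mul (c := max C 0) ((InnerCStarModule.continuous_inner.comp_aestronglyMeasurable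
    (hk.prodMk hψ.1)).indicator hΔ) ?_
  filter_upwards [hC] with x hx
  exact norm_indicator_inner_le k ψ hx

/-- The reconstruction formula `V h = ∫ |k x⟩ h(x) dμ(x)` yields the adjoint of an isometry `W` into
the square integrable functions that is given by `(W f)(x) = ⟨k x | f⟩`. -/
theorem exists_adjoint_of_represents [IsFiniteMeasure μ] [CompleteSpace H]
    (hsep : ∀ a b : D, (∀ φ : D →ₚ[ℂ] ℂ, φ a = φ b) → a = b)
    {k : X → H} (hk : AEStronglyMeasurable k μ) (W : H → L2Module μ D)
    (hWi : ∀ f g, ⟪W f, W g⟫_D = ⟪f, g⟫_D)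
    (hW : ∀ f, (W f).Represents fun x => ⟪k x, f⟫_D) :
    ∃ V : L2Module μ D →L[ℂ] H, ∀ f η, ⟪f, V η⟫_D = ⟪W f, η⟫_D := by
  refine exists_adjoint (A := D) W hWi (s := {η | ∃ h, ∃ hh : MemLp h 2 μ,
    Integrable (fun x => ‖h x‖ * ‖k x‖) μ ∧ η = L2Module.of h hh}) ?_ ?_
  · refine dense_closure.mp ((L2Module.dense_range_of μ D).mono ?_)
    rintro _ ⟨h, hh, rfl⟩
    obtain ⟨s, hs, hb, -, hμ⟩ := exists_measurableSet_norm_le hk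
    refine mem_closure_of_tendsto (L2Module.tendsto_indicatorMul hs hμ _)
      (.of_forall fun n => ⟨_, hh.indicator (hs n), ?_, L2Module.indicatorMul_of (hs n) hh⟩)
    refine ((hh.integrable one_le_two).norm.mul_const n).mono'
      ((hh.indicator (hs n)).1.norm.mul hk.norm) ?_
    filter_upwards [hb n] with x hx
    rw [norm_mul, norm_norm, norm_norm]
    by_cases hxs : x ∈ s n
    · rw [Set.indicator_of_mem hxs]
      exact mul_le_mul_of_nonneg_left (hx hxs) (norm_nonneg _)
    · rw [Set.indicator_of_notMem hxs, norm_zero, zero_mul]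
      positivity
  · rintro _ ⟨h, hh, hint, rfl⟩
    have hI : Integrable (fun x => k x <• h x) μ :=
      hint.mono' (continuous_opSMul.comp_aestronglyMeasurable (hk.prodMk hh.1))
        (.of_forall fun x => norm_op_smul_le (h x) (k x))
    refine ⟨∫ x, k x <• h x ∂μ, fun z => ?_⟩
    have h1 := (innerCLM D z).integral_comp_comm hI
    have h2 := hasWeakIntegral_integral ((innerCLM D z).integrable_comp hI)
    rw [h1, innerCLM_apply] at h2
    refine h2.unique hsep ?_
    convert (hW z).hasWeakIntegral_univ (L2Module.represents_of hh) using 2 with x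
    rw [innerCLM_apply, inner_op_smul_right, star_inner]

section Adjoint

variable {W : H →ₗᵢ[Dᵐᵒᵖ] L2Module μ D} {V : L2Module μ D →L[ℂ] H}

theorem adjoint_comp_self (hWi : ∀ f g, ⟪W f, W g⟫_D = ⟪f, g⟫_D)
    (hV : ∀ f η, ⟪f, V η⟫_D = ⟪W f, η⟫_D) (f : H) : V (W f) = f :=
  ext_inner (A := D) fun z => by rw [hV, hWi]

variable (W V) in
/-- The operator `W V` on the square integrable functions. -/
def rangeProjection : L2Module μ D →L[ℂ] L2Module μ D :=
  W.toContinuousLinearMap.restrictScalars ℂ ∘L V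

theorem rangeProjection_apply (η : L2Module μ D) : rangeProjection W V η = W (V η) := rfl

theorem rangeProjection_of_mem (hWi : ∀ f g, ⟪W f, W g⟫_D = ⟪f, g⟫_D)
    (hV : ∀ f η, ⟪f, V η⟫_D = ⟪W f, η⟫_D) (f : LinearMap.range W.toLinearMap) :
    rangeProjection W V f = f := by
  obtain ⟨_, f, rfl⟩ := f
  exact congrArg W (adjoint_comp_self hWi hV f)

theorem isOrthogonalProjection_rangeProjection (hWi : ∀ f g, ⟪W f, W g⟫_D = ⟪f, g⟫_D)
    (hV : ∀ f η, ⟪f, V η⟫_D = ⟪W f, η⟫_D) :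
    IsOrthogonalProjection (LinearMap.range W.toLinearMap) (rangeProjection W V) where
  selfAdjoint x y := by
    rw [rangeProjection_apply, rangeProjection_apply, ← hV, ← star_inner (W (V y)), ← hV,
      star_inner]
  idempotent x := congrArg W (adjoint_comp_self hWi hV (V x))
  range_eq := by
    ext η
    constructor
    · rintro ⟨ζ, rfl⟩
      exact ⟨V ζ, rfl⟩
    · rintro ⟨f, rfl⟩
      exact ⟨W f, congrArg W (adjoint_comp_self hWi hV f)⟩

theorem isKernelOperator_rangeProjection [IsFiniteMeasure μ] {k : X → H}
    (hW : ∀ f, (W f).Represents fun x => ⟪k x, f⟫_D) (hV : ∀ f η, ⟪f, V η⟫_D = ⟪W f, η⟫_D) :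
    IsKernelOperator μ (fun x y => ⟪k x, k y⟫_D) (rangeProjection W V) := fun h hh => by
  refine ⟨fun x => ⟪k x, V (L2Module.of h hh)⟫_D, fun x => ?_, hW _⟩
  beta_reduce
  rw [hV]
  convert (hW (k x)).hasWeakIntegral_univ (L2Module.represents_of hh) using 2 with y
  rw [star_inner]

variable (W V) in
/-- The compressions of the multiplication operators to the range of `W`. -/
def compression (Δ : Set X) (hΔ : MeasurableSet Δ) :
    LinearMap.range W.toLinearMap →L[ℂ] LinearMap.range W.toLinearMap where
  toFun f := ⟨rangeProjection W V (L2Module.indicatorMul μ D Δ hΔ f), _, rfl⟩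
  map_add' f g := Subtype.ext (by simp)
  map_smul' c f := Subtype.ext (by simp)
  cont := Continuous.subtype_mk (by fun_prop) _

theorem coe_compression {Δ : Set X} (hΔ : MeasurableSet Δ) (f : LinearMap.range W.toLinearMap) :
    (compression W V Δ hΔ f : L2Module μ D) =
      rangeProjection W V (L2Module.indicatorMul μ D Δ hΔ f) := rfl

theorem inner_compression (hWi : ∀ f g, ⟪W f, W g⟫_D = ⟪f, g⟫_D)
    (hV : ∀ f η, ⟪f, V η⟫_D = ⟪W f, η⟫_D) {Δ : Set X} (hΔ : MeasurableSet Δ)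
    (f g : LinearMap.range W.toLinearMap) :
    ⟪f, compression W V Δ hΔ g⟫_D =
      ⟪(f : L2Module μ D), L2Module.indicatorMul μ D Δ hΔ g⟫_D := by
  change ⟪(f : L2Module μ D), rangeProjection W V (L2Module.indicatorMul μ D Δ hΔ g)⟫_D = _
  rw [← (isOrthogonalProjection_rangeProjection hWi hV).selfAdjoint,
    rangeProjection_of_mem hWi hV]

theorem isIntegralOfKetBra_compression [IsFiniteMeasure μ]
    (hWi : ∀ f g, ⟪W f, W g⟫_D = ⟪f, g⟫_D) {k : X → H}
    (hW : ∀ f, (W f).Represents fun x => ⟪k x, f⟫_D) (hV : ∀ f η, ⟪f, V η⟫_D = ⟪W f, η⟫_D) :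
    IsIntegralOfKetBra D μ (fun x => (⟨W (k x), k x, rfl⟩ : LinearMap.range W.toLinearMap))
      (compression W V) := fun Δ hΔ f g => by
  rw [inner_compression hWi hV]
  obtain ⟨_, f, rfl⟩ := f
  obtain ⟨_, g, rfl⟩ := g
  have h : (fun x => star ⟪k x, f⟫_D * ⟪k x, g⟫_D) =
      fun x => ⟪W f, W (k x)⟫_D * ⟪W (k x), W g⟫_D := by
    ext x
    rw [star_inner, hWi, hWi]
  exact h ▸ (hW f).hasWeakIntegral (hW g) hΔ

theorem isPOVMeasure_compression [IsFiniteMeasure μ] (hWi : ∀ f g, ⟪W f, W g⟫_D = ⟪f, g⟫_D)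
    (hV : ∀ f η, ⟪f, V η⟫_D = ⟪W f, η⟫_D) : IsPOVMeasure D (compression W V) where
  selfAdjoint Δ hΔ x y := by
    rw [← star_inner y, inner_compression hWi hV, inner_compression hWi hV, star_inner,
      L2Module.inner_indicatorMul]
  nonneg Δ hΔ x := by
    rw [inner_compression hWi hV]
    exact (L2Module.isPVMeasure_indicatorMul μ D).nonneg Δ hΔ _
  univ := ContinuousLinearMap.ext fun x => Subtype.ext <| by
    rw [coe_compression, L2Module.indicatorMul_univ, rangeProjection_of_mem hWi hV]
    rfl
  hasSum s hs hd x := by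
    have h := (L2Module.hasSum_indicatorMul hs hd (x : L2Module μ D)).mapL (rangeProjection W V)
    exact (Topology.IsInducing.subtypeVal.hasSum_iff
      (g := (LinearMap.range W.toLinearMap).subtype) _ _).mp h

end Adjoint

theorem of_inner_mem_closure_span {W : H →ₗᵢ[Dᵐᵒᵖ] L2Module μ D} {k : X → H}
    (hk : AEStronglyMeasurable k μ) (hW : ∀ f, (W f).Represents fun x => ⟪k x, f⟫_D)
    {Δ : Set X} (hΔ : MeasurableSet Δ) {C : ℝ} (hC : ∀ᵐ x ∂μ, x ∈ Δ → ‖k x‖ ≤ C) {ψ : X → H}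
    (hψ : MemLp ψ 2 μ) (hm : MemLp (Δ.indicator fun x => ⟪k x, ψ x⟫_D) 2 μ) :
    L2Module.of _ hm ∈ (Submodule.span ℂ {v : L2Module μ D | ∃ (Δ : Set X) (hΔ : MeasurableSet Δ),
      ∃ h ∈ LinearMap.range W.toLinearMap,
        v = L2Module.indicatorMul μ D Δ hΔ h}).topologicalClosure := by
  set T := (Submodule.span ℂ {v : L2Module μ D | ∃ (Δ : Set X) (hΔ : MeasurableSet Δ),
    ∃ h ∈ LinearMap.range W.toLinearMap,
      v = L2Module.indicatorMul μ D Δ hΔ h}).topologicalClosure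
  have hTc : IsClosed (T : Set (L2Module μ D)) := Submodule.isClosed_topologicalClosure _
  have hmem : ∀ {ψ : X → H}, MemLp ψ 2 μ → MemLp (Δ.indicator fun x => ⟪k x, ψ x⟫_D) 2 μ :=
    fun hψ => memLp_indicator_inner hk hΔ hC hψ
  suffices h : ∀ ⦃ψ : X → H⦄, MemLp ψ 2 μ → ∀ hm : MemLp (Δ.indicator fun x => ⟪k x, ψ x⟫_D) 2 μ,
      L2Module.of _ hm ∈ T from h hψ hm
  clear hm hψ ψ
  refine fun ψ hψ => MemLp.induction (p := 2) ENNReal.ofNat_ne_top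
    (fun ψ => ∀ hm : MemLp (Δ.indicator fun x => ⟪k x, ψ x⟫_D) 2 μ, L2Module.of _ hm ∈ T)
    ?_ ?_ ?_ ?_ hψ
  · intro f s hs _ hm
    have heq : (Δ.indicator fun x => ⟪k x, s.indicator (fun _ => f) x⟫_D) =
        (Δ ∩ s).indicator fun x => ⟪k x, f⟫_D := by
      rw [← Set.indicator_indicator]
      congr 1
      ext x
      by_cases hx : x ∈ s <;> simp [hx, InnerCStarModule.inner_zero_right]
    have hm' := heq ▸ hm
    rw [L2Module.of_congr hm hm' (.of_eq heq), ← (hW f).2 _ (hΔ.inter hs) hm']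
    exact Submodule.le_topologicalClosure _ (Submodule.subset_span
      ⟨Δ ∩ s, hΔ.inter hs, W f, ⟨f, rfl⟩, rfl⟩)
  · intro f g _ hf hg ihf ihg hm
    have heq : (Δ.indicator fun x => ⟪k x, (f + g) x⟫_D) =
        (Δ.indicator fun x => ⟪k x, f x⟫_D) + Δ.indicator fun x => ⟪k x, g x⟫_D := by
      rw [← Set.indicator_add']
      congr 1
      ext x
      exact InnerCStarModule.inner_add_right _ _ _
    rw [L2Module.of_congr hm ((hmem hf).add (hmem hg)) (.of_eq heq),
      L2Module.of_add (hmem hf) (hmem hg)]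
    exact T.add_mem (ihf _) (ihg _)
  · refine IsSeqClosed.isClosed fun ψ ψ₀ hψ hlim hm => ?_
    refine hTc.mem_of_tendsto (b := atTop)
      (f := fun n => L2Module.of _ (hmem (Lp.memLp (ψ n)))) ?_ (.of_forall fun n => hψ n _)
    rw [tendsto_iff_norm_sub_tendsto_zero] at hlim ⊢
    have h0 := hlim.const_mul (max C 0)
    rw [mul_zero] at h0
    refine squeeze_zero (fun _ => norm_nonneg _) (fun n => ?_) h0
    rw [← L2Module.of_sub]
    have h1 : 0 ≤ max C 0 := le_max_right _ _
    refine (L2Module.norm_of_le _).trans ?_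
    rw [Lp.norm_def, ← ENNReal.toReal_ofReal h1, ← ENNReal.toReal_mul]
    refine ENNReal.toReal_mono (ENNReal.mul_ne_top ENNReal.ofReal_ne_top (Lp.eLpNorm_ne_top _)) ?_
    refine eLpNorm_le_mul_eLpNorm_of_ae_le_mul ?_ 2
    filter_upwards [hC, Lp.coeFn_sub (ψ n) ψ₀] with x hx hsub
    rw [hsub, ← Set.indicator_sub']
    have h2 := norm_indicator_inner_le (D := D) k (ψ n - ψ₀ : X → H) hx
    simp only [Pi.sub_apply, InnerCStarModule.inner_sub_right] at h2
    exact h2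
  · intro f g hfg hf ih hm
    rw [L2Module.of_congr hm (hmem hf)]
    · exact ih _
    · filter_upwards [hfg] with x hx
      simp only [Set.indicator, hx]

theorem isMinimalDilation_of_isUnit [IsFiniteMeasure μ] {W : H →ₗᵢ[Dᵐᵒᵖ] L2Module μ D} {k : X → H}
    (hk : AEStronglyMeasurable k μ) (hW : ∀ f, (W f).Represents fun x => ⟪k x, f⟫_D)
    (hu : ∀ x, IsUnit ⟪k x, k x⟫_D) :
    IsMinimalDilation (LinearMap.range W.toLinearMap) (L2Module.indicatorMul μ D) := by
  have hK : AEStronglyMeasurable (fun x => ((hu x).unit : D)) μ :=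
    InnerCStarModule.continuous_inner.comp_aestronglyMeasurable (hk.prodMk hk)
  have he : IsEmbedding (Units.val : Dˣ → D) := Units.isOpenEmbedding_val.isEmbedding
  have : TopologicalSpace.PseudoMetrizableSpace Dˣ := he.isInducing.pseudoMetrizableSpace
  have hinv : AEStronglyMeasurable (fun x => ((hu x).unit⁻¹ : Dˣ).val) μ :=
    (Units.continuous_val.comp continuous_inv).comp_aestronglyMeasurable
      (he.aestronglyMeasurable_comp_iff.mp hK)
  refine dense_closure.mp ((L2Module.dense_range_of μ D).mono ?_)
  rintro _ ⟨h, hh, rfl⟩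
  obtain ⟨s, hs, hb, -, hμ⟩ := exists_measurableSet_norm_le (hk.prodMk hinv)
  rw [← Submodule.topologicalClosure_coe]
  refine (Submodule.isClosed_topologicalClosure _).mem_of_tendsto
    (L2Module.tendsto_indicatorMul hs hμ _) (.of_forall fun n => ?_)
  have hb1 : ∀ᵐ x ∂μ, x ∈ s n → ‖k x‖ ≤ n := by
    filter_upwards [hb n] with x hx hxs using (norm_fst_le (k x, _)).trans (hx hxs)
  let ψ : X → H := (s n).indicator fun x => k x <• (((hu x).unit⁻¹ : Dˣ).val * h x)
  have hψ : MemLp ψ 2 μ := by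
    refine hh.of_le_mul (c := n * n) ((continuous_opSMul.comp_aestronglyMeasurable
      (hk.prodMk (hinv.mul hh.1))).indicator (hs n)) ?_
    filter_upwards [hb n] with x hx
    by_cases hxs : x ∈ s n
    · simp only [ψ, Set.indicator_of_mem hxs]
      have h1 := (norm_fst_le (k x, ((hu x).unit⁻¹ : Dˣ).val)).trans (hx hxs)
      have h2 := (norm_snd_le (k x, ((hu x).unit⁻¹ : Dˣ).val)).trans (hx hxs)
      calc _ ≤ ‖((hu x).unit⁻¹ : Dˣ).val * h x‖ * ‖k x‖ := norm_op_smul_le _ _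
        _ ≤ (n * ‖h x‖) * n := by
          gcongr
          exact (norm_mul_le _ _).trans (by gcongr)
        _ = n * n * ‖h x‖ := by ring
    · simp only [ψ, Set.indicator_of_notMem hxs, norm_zero]
      positivity
  have heq : ((s n).indicator fun x => ⟪k x, ψ x⟫_D) = (s n).indicator h := by
    ext x
    by_cases hxs : x ∈ s n
    · simp only [ψ, Set.indicator_of_mem hxs]
      rw [inner_op_smul_right, ← mul_assoc]
      have h1 : ⟪k x, k x⟫_D * ((hu x).unit⁻¹ : Dˣ).val = 1 := (hu x).mul_val_inv
      rw [h1, one_mul]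
    · simp only [Set.indicator_of_notMem hxs]
  have hm := memLp_indicator_inner (D := D) hk (hs n) hb1 hψ
  rw [L2Module.indicatorMul_of, L2Module.of_congr _ hm (.of_eq heq.symm)]
  exact of_inner_mem_closure_span hk hW (hs n) hb1 hψ hm

end AnalysisOperator

section CoherentStateLemmas

open Filter Topology InnerCStarModule

variable {B C : Type*} [CStarAlgebra B] [PartialOrder B] [StarOrderedRing B]
  [CStarAlgebra C] [PartialOrder C] [StarOrderedRing C]

/-- The positive functional `d ↦ ⟨v, π(d) v⟩` of a representation `π`. -/
def vectorFunctional {D K : Type*} [CStarAlgebra D] [PartialOrder D] [StarOrderedRing D]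
    [NormedAddCommGroup K] [InnerProductSpace ℂ K] [CompleteSpace K] (π : D →⋆ₐ[ℂ] (K →L[ℂ] K))
    (v : K) : D →ₚ[ℂ] ℂ :=
  PositiveLinearMap.mk₀
    { toFun := fun d => ⟪v, π d v⟫_ℂ
      map_add' := fun d d' => by rw [map_add, add_apply, _root_.inner_add_right]
      map_smul' := fun z d => by
        rw [map_smul, smul_apply, _root_.inner_smul_right, RingHom.id_apply, smul_eq_mul] }
    fun _ hd => ((ContinuousLinearMap.nonneg_iff_isPositive _).mp
      (map_nonneg π hd)).inner_nonneg_right v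

namespace MinTensor

theorem zero_tmul (c : C) : tmul (0 : B) c = 0 := by
  simpa using smul_tmul (0 : ℂ) (0 : B) c

theorem tmul_zero (b : B) : tmul b (0 : C) = 0 := by
  simpa using tmul_smul (0 : ℂ) b (0 : C)

variable (B C) in
/-- The embedding `b ↦ b ⊗ 1`. -/
def includeLeft : B →⋆ₐ[ℂ] MinTensor B C where
  toFun b := tmul b 1
  map_one' := tmul_one_one
  map_mul' b b' := by rw [tmul_mul_tmul, one_mul]
  map_zero' := zero_tmul 1
  map_add' b b' := add_tmul b b' 1
  commutes' z := by
    rw [Algebra.algebraMap_eq_smul_one, smul_tmul, tmul_one_one, Algebra.algebraMap_eq_smul_one]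
  map_star' b := by rw [star_tmul, star_one]

variable (B C) in
/-- The embedding `c ↦ 1 ⊗ c`. -/
def includeRight : C →⋆ₐ[ℂ] MinTensor B C where
  toFun c := tmul 1 c
  map_one' := tmul_one_one
  map_mul' c c' := by rw [tmul_mul_tmul, one_mul]
  map_zero' := tmul_zero 1
  map_add' c c' := tmul_add 1 c c'
  commutes' z := by
    rw [Algebra.algebraMap_eq_smul_one, tmul_smul, tmul_one_one, Algebra.algebraMap_eq_smul_one]
  map_star' c := by rw [star_tmul, star_one]

theorem norm_tmul_le (b : B) (c : C) : ‖tmul b c‖ ≤ ‖b‖ * ‖c‖ := by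
  have h : tmul b c = includeLeft B C b * includeRight B C c := by
    change tmul b c = tmul b 1 * tmul 1 c
    rw [tmul_mul_tmul, one_mul, mul_one]
  rw [h]
  exact (norm_mul_le _ _).trans (mul_le_mul (NonUnitalStarAlgHom.norm_apply_le (includeLeft B C) b)
    (NonUnitalStarAlgHom.norm_apply_le (includeRight B C) c) (norm_nonneg _) (norm_nonneg _))

theorem eq_of_forall_functional {a b : MinTensor B C}
    (h : ∀ φ : MinTensor B C →ₚ[ℂ] ℂ, φ a = φ b) : a = b := by
  refine toOperator_injective (ContinuousLinearMap.coe_injective ?_)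
  refine (ext_inner_map _ _).mp fun v => ?_
  have h1 : ⟪v, toOperator a v⟫_ℂ = ⟪v, toOperator b v⟫_ℂ := h (vectorFunctional toOperator v)
  change ⟪toOperator a v, v⟫_ℂ = ⟪toOperator b v, v⟫_ℂ
  rw [← inner_conj_symm, ← inner_conj_symm (toOperator b v)]
  exact congrArg _ h1

end MinTensor

variable {E G : Type*}
  [NormedAddCommGroup E] [NormedSpace ℂ E] [Module Bᵐᵒᵖ E] [InnerCStarModule B E]
  [NormedAddCommGroup G] [NormedSpace ℂ G] [Module Cᵐᵒᵖ G] [InnerCStarModule C G]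

namespace ExteriorTensor

theorem ext_tmul {x y : ExteriorTensor B C E G}
    (h : ∀ e g, ⟪tmul B C e g, x⟫_(MinTensor B C) = ⟪tmul B C e g, y⟫_(MinTensor B C)) : x = y := by
  refine ext_inner (A := MinTensor B C) fun z => ?_
  refine (dense_span_tmul (B := B) (C := C) (E := E) (G := G)).induction
    (P := fun z => ⟪z, x⟫_(MinTensor B C) = ⟪z, y⟫_(MinTensor B C)) (fun z hz => ?_) ?_ z
  · induction hz using Submodule.span_induction with
    | mem z hz => obtain ⟨⟨e, g⟩, rfl⟩ := hz; exact h e g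
    | zero => rw [InnerCStarModule.inner_zero_left, InnerCStarModule.inner_zero_left]
    | add z z' _ _ hz hz' =>
      rw [InnerCStarModule.inner_add_left, InnerCStarModule.inner_add_left, hz, hz']
    | smul a z _ hz =>
      rw [← MulOpposite.op_unop a, inner_op_smul_left, inner_op_smul_left, hz]
  · exact isClosed_eq (continuous_inner_comp continuous_id continuous_const)
      (continuous_inner_comp continuous_id continuous_const)

theorem norm_tmul_le (e : E) (g : G) : ‖tmul B C e g‖ ≤ ‖e‖ * ‖g‖ := by
  refine abs_le_of_sq_le_sq' ?_ (by positivity) |>.2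
  rw [mul_pow, norm_sq_eq (A := MinTensor B C), inner_tmul, norm_sq_eq (A := B) e,
    norm_sq_eq (A := C) g]
  exact MinTensor.norm_tmul_le _ _

variable (B C E G) in
/-- The elementary tensor `e ⊗ g` as a continuous bilinear map. -/
def tmulCLM : E →L[ℂ] G →L[ℂ] ExteriorTensor B C E G :=
  LinearMap.mkContinuous₂
    (LinearMap.mk₂ ℂ (fun e g => tmul B C e g)
      (fun e e' g => ext_tmul fun e₀ g₀ => by
        rw [InnerCStarModule.inner_add_right, inner_tmul, inner_tmul, inner_tmul,
          InnerCStarModule.inner_add_right, MinTensor.add_tmul])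
      (fun z e g => ext_tmul fun e₀ g₀ => by
        rw [InnerCStarModule.inner_smul_right, inner_tmul, inner_tmul,
          InnerCStarModule.inner_smul_right, MinTensor.smul_tmul])
      (fun e g g' => ext_tmul fun e₀ g₀ => by
        rw [InnerCStarModule.inner_add_right, inner_tmul, inner_tmul, inner_tmul,
          InnerCStarModule.inner_add_right, MinTensor.tmul_add])
      (fun z e g => ext_tmul fun e₀ g₀ => by
        rw [InnerCStarModule.inner_smul_right, inner_tmul, inner_tmul,
          InnerCStarModule.inner_smul_right, MinTensor.tmul_smul]))
    1 fun e g => by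
      rw [one_mul]
      exact norm_tmul_le e g

theorem tmulCLM_apply (e : E) (g : G) : tmulCLM B C E G e g = tmul B C e g := rfl

theorem tmul_op_smul (e : E) (g : G) (c : C) :
    tmul B C e (g <• c) = tmul B C e g <• MinTensor.tmul (1 : B) c :=
  ext_tmul fun e₀ g₀ => by
    rw [inner_tmul, inner_op_smul_right, inner_op_smul_right, inner_tmul, MinTensor.tmul_mul_tmul,
      mul_one]

end ExteriorTensor

variable {A X κ : Type*} [CStarAlgebra A] [MeasurableSpace X] {μ : Measure X}
  {F : κ → X → E} {φ : κ → G}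

namespace IsCoherentSystem

theorem memLp (hF : IsCoherentSystem B C μ F φ) (k : κ) : MemLp (F k) 2 μ := by
  rw [memLp_two_iff_integrable_sq_norm (hF.aestronglyMeasurable k)]
  refine (hF.integrable_inner k).norm.congr (.of_forall fun x => ?_)
  exact (norm_sq_eq (A := B) (F k x)).symm

theorem integrable_op_smul (hF : IsCoherentSystem B C μ F φ) (k l : κ) (e : E) :
    Integrable (fun x => F k x <• ⟪F l x, e⟫_B) μ := by
  have h := ((hF.memLp k).norm.integrable_mul (hF.memLp l).norm).mul_const ‖e‖
  refine h.mono' (continuous_opSMul.comp_aestronglyMeasurable ((hF.aestronglyMeasurable k).prodMk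
    (InnerCStarModule.continuous_inner.comp_aestronglyMeasurable
      ((hF.aestronglyMeasurable l).prodMk aestronglyMeasurable_const)))) (.of_forall fun x => ?_)
  refine (norm_op_smul_le _ _).trans ?_
  have h1 := norm_inner_le (A := B) (F l x) e
  calc _ ≤ (‖F l x‖ * ‖e‖) * ‖F k x‖ := by gcongr
    _ = ‖F k x‖ * ‖F l x‖ * ‖e‖ := by ring

theorem memLp_tmul_inner (hF : IsCoherentSystem B C μ F φ) (k : κ) (e : E) :
    MemLp (fun x => MinTensor.tmul ⟪F k x, e⟫_B (1 : C)) 2 μ := by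
  have h1 : Continuous (MinTensor.includeLeft B C) := map_continuous _
  refine (hF.memLp k).of_le_mul (c := ‖e‖ * ‖(1 : C)‖) (h1.comp_aestronglyMeasurable
    (InnerCStarModule.continuous_inner.comp_aestronglyMeasurable
      ((hF.aestronglyMeasurable k).prodMk aestronglyMeasurable_const))) (.of_forall fun x => ?_)
  refine (MinTensor.norm_tmul_le _ _).trans ?_
  have h2 := norm_inner_le (A := B) (F k x) e
  calc _ ≤ (‖F k x‖ * ‖e‖) * ‖(1 : C)‖ := by gcongr
    _ = ‖e‖ * ‖(1 : C)‖ * ‖F k x‖ := by ring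

theorem inner_of_tmul_inner [CompleteSpace E] (hF : IsCoherentSystem B C μ F φ) (k l : κ)
    (e e' : E) :
    ⟪L2Module.of _ (hF.memLp_tmul_inner k e), L2Module.of _ (hF.memLp_tmul_inner l e')⟫_(
      MinTensor B C) = MinTensor.tmul ⟪e, e'⟫_B ⟪φ k, φ l⟫_C := by
  classical
  have hF' : ∫ x, F k x <• ⟪F l x, e'⟫_B ∂μ = if k = l then e' else 0 := by
    split_ifs with h
    · subst h; exact hF.integral_self k e'
    · exact hF.integral_of_ne k l h e'
  let ι : B →L[ℂ] MinTensor B C :=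
    ⟨(MinTensor.includeLeft B C).toAlgHom.toLinearMap, map_continuous (MinTensor.includeLeft B C)⟩
  have h1 := (ι ∘L innerCLM B e).integral_comp_comm (hF.integrable_op_smul k l e')
  rw [hF'] at h1
  rw [L2Module.inner_of]
  have h2 : ∀ x, star (MinTensor.tmul ⟪F k x, e⟫_B (1 : C)) * MinTensor.tmul ⟪F l x, e'⟫_B 1 =
      (ι ∘L innerCLM B e) (F k x <• ⟪F l x, e'⟫_B) := fun x => by
    change _ = MinTensor.tmul ⟪e, F k x <• ⟪F l x, e'⟫_B⟫_B 1
    rw [MinTensor.star_tmul, MinTensor.tmul_mul_tmul, star_inner, inner_op_smul_right, star_one,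
      one_mul]
  simp only [h2, h1]
  change MinTensor.tmul ⟪e, _⟫_B 1 = _
  split_ifs with h
  · subst h; rw [hF.inner_self]
  · rw [hF.inner_of_ne k l h, InnerCStarModule.inner_zero_right, MinTensor.zero_tmul,
      MinTensor.tmul_zero]

theorem hasSum_ket (hF : IsCoherentSystem B C μ F φ) (c : Correspondence A B E) (x : X) :
    HasSum (fun k => ExteriorTensor.tmul B C (F k x) (φ k)) (ket C c F φ x 1) := by
  have h1 : ∀ k, c.act 1 (F k x) = F k x := fun k => by rw [map_one]; rfl
  simpa only [ket, h1] using (hF.summable x).hasSum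

theorem aestronglyMeasurable_ket [Countable κ] (hF : IsCoherentSystem B C μ F φ)
    (c : Correspondence A B E) : AEStronglyMeasurable (fun x => ket C c F φ x 1) μ := by
  refine aestronglyMeasurable_of_tendsto_ae (u := (atTop : Filter (Finset κ)))
    (f := fun s x => ∑ k ∈ s, ExteriorTensor.tmul B C (F k x) (φ k)) (fun s => ?_)
    (.of_forall fun x => hF.hasSum_ket c x)
  refine Finset.aestronglyMeasurable_fun_sum s fun k _ => ?_
  exact ((ExteriorTensor.tmulCLM B C E G).flip (φ k)).continuous.comp_aestronglyMeasurable
    (hF.aestronglyMeasurable k)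

theorem inner_ket_tmul (hF : IsCoherentSystem B C μ F φ) (c : Correspondence A B E) (x : X) (e : E)
    (j : κ) :
    ⟪ket C c F φ x 1, ExteriorTensor.tmul B C e (φ j)⟫_(MinTensor B C) =
      MinTensor.tmul ⟪F j x, e⟫_B 1 := by
  have h := (hF.hasSum_ket c x).mapL (innerCLM (MinTensor B C) (ExteriorTensor.tmul B C e (φ j)))
  have h1 := h.unique (hasSum_single j fun k hk => by
    rw [innerCLM_apply, ExteriorTensor.inner_tmul, hF.inner_of_ne j k hk.symm,
      MinTensor.tmul_zero])
  rw [innerCLM_apply, innerCLM_apply, ExteriorTensor.inner_tmul, hF.inner_self] at h1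
  rw [← star_inner, h1, MinTensor.star_tmul, star_inner, star_one]

theorem dense_span_tmul (hF : IsCoherentSystem B C μ F φ) :
    Dense (Submodule.span (MinTensor B C)ᵐᵒᵖ
      (Set.range fun p : E × κ => ExteriorTensor.tmul B C p.1 (φ p.2)) :
        Set (ExteriorTensor B C E G)) := by
  set S := Submodule.span (MinTensor B C)ᵐᵒᵖ
    (Set.range fun p : E × κ => ExteriorTensor.tmul B C p.1 (φ p.2))
  have hle : Submodule.span (MinTensor B C)ᵐᵒᵖ
      (Set.range fun p : E × G => ExteriorTensor.tmul B C p.1 p.2) ≤ S.topologicalClosure := by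
    refine Submodule.span_le.mpr ?_
    rintro _ ⟨⟨e, g⟩, rfl⟩
    have h := (hF.hasSum_frame g).mapL (ExteriorTensor.tmulCLM B C E G e)
    refine mem_closure_of_tendsto h (.of_forall fun s => ?_)
    refine S.sum_mem fun k _ => ?_
    rw [ExteriorTensor.tmulCLM_apply, ExteriorTensor.tmul_op_smul]
    exact S.smul_mem _ (Submodule.subset_span ⟨(e, k), rfl⟩)
  exact dense_closure.mp (ExteriorTensor.dense_span_tmul.mono hle)

theorem exists_isAnalysisMap [CompleteSpace E] [Countable κ] [IsFiniteMeasure μ]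
    (hF : IsCoherentSystem B C μ F φ) (c : Correspondence A B E) :
    ∃ W : ExteriorTensor B C E G →ₗᵢ[(MinTensor B C)ᵐᵒᵖ] L2Module μ (MinTensor B C),
      IsAnalysisMap c F φ μ W ∧
        ∀ f g, ⟪W f, W g⟫_(MinTensor B C) = ⟪f, g⟫_(MinTensor B C) := by
  obtain ⟨W, hW, hWi⟩ := exists_linearIsometry (A := MinTensor B C)
    (fun p : E × κ => ExteriorTensor.tmul B C p.1 (φ p.2))
    (fun p => L2Module.of _ (hF.memLp_tmul_inner p.2 p.1)) hF.dense_span_tmul fun p q => by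
      rw [ExteriorTensor.inner_tmul, hF.inner_of_tmul_inner]
  refine ⟨W, fun f => ?_, hWi⟩
  have hspan : ∀ f ∈ Submodule.span (MinTensor B C)ᵐᵒᵖ
      (Set.range fun p : E × κ => ExteriorTensor.tmul B C p.1 (φ p.2)),
      ∃ hm : MemLp (fun x => ⟪ket C c F φ x 1, f⟫_(MinTensor B C)) 2 μ,
        L2Module.of _ hm = W f := fun f hf => by
    induction hf using Submodule.span_induction with
    | mem f hf =>
      obtain ⟨⟨e, j⟩, rfl⟩ := hf
      simp only [hF.inner_ket_tmul]
      exact ⟨hF.memLp_tmul_inner j e, (hW (e, j)).symm⟩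
    | zero =>
      simp only [InnerCStarModule.inner_zero_right, map_zero]
      exact ⟨MemLp.zero, L2Module.of_zero⟩
    | add f g _ _ hf hg =>
      obtain ⟨hf, hf'⟩ := hf
      obtain ⟨hg, hg'⟩ := hg
      simp only [InnerCStarModule.inner_add_right, map_add]
      exact ⟨hf.add hg, by rw [← hf', ← hg', ← L2Module.of_add]; rfl⟩
    | smul a f _ hf =>
      obtain ⟨hf, hf'⟩ := hf
      rw [← MulOpposite.op_unop a]
      simp only [inner_op_smul_right, map_smul]
      have hfa : MemLp (fun x => ⟪ket C c F φ x 1, f⟫_(MinTensor B C) * a.unop) 2 μ :=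
        hf.const_smul a
      exact ⟨hfa, by rw [L2Module.of_op_smul a.unop hf hfa, hf']⟩
  obtain ⟨u, hu, hlim⟩ := mem_closure_iff_seq_limit.mp (hF.dense_span_tmul f)
  choose hm hum using fun n => hspan (u n) (hu n)
  refine L2Module.represents_of_tendsto hm ?_ (.of_forall fun x =>
    ((innerCLM (MinTensor B C) (ket C c F φ x 1)).continuous.tendsto f).comp hlim)
  simp only [hum]
  exact (W.continuous.tendsto f).comp hlim

end IsCoherentSystem

theorem IsAnalysisMap.unique [IsFiniteMeasure μ] {c : Correspondence A B E}
    {W W' : ExteriorTensor B C E G →ₗᵢ[(MinTensor B C)ᵐᵒᵖ] L2Module μ (MinTensor B C)}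
    (hW : IsAnalysisMap c F φ μ W) (hW' : IsAnalysisMap c F φ μ W') : W = W' :=
  LinearIsometry.ext fun f => (hW f).unique (hW' f)

end CoherentStateLemmas

end

theorem mainTheorem4
    {A B C E G X κ : Type*}
    [CStarAlgebra A] [CStarAlgebra B] [PartialOrder B] [StarOrderedRing B]
    [CStarAlgebra C] [PartialOrder C] [StarOrderedRing C]
    [NormedAddCommGroup E] [NormedSpace ℂ E] [CompleteSpace E] [Module Bᵐᵒᵖ E]
    [InnerCStarModule B E]
    [NormedAddCommGroup G] [NormedSpace ℂ G] [CompleteSpace G] [Module Cᵐᵒᵖ G]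
    [InnerCStarModule C G]
    [MeasurableSpace X] (μ : Measure X) [IsFiniteMeasure μ] [Countable κ]
    (c : Correspondence A B E) (F : κ → X → E) (φ : κ → G) (hF : IsCoherentSystem B C μ F φ) :
    (∃! W : ExteriorTensor B C E G →ₗᵢ[(MinTensor B C)ᵐᵒᵖ] L2Module μ (MinTensor B C),
      IsAnalysisMap c F φ μ W) ∧
    ∀ W : ExteriorTensor B C E G →ₗᵢ[(MinTensor B C)ᵐᵒᵖ] L2Module μ (MinTensor B C),
      IsAnalysisMap c F φ μ W →
      let HK : Submodule (MinTensor B C)ᵐᵒᵖ (L2Module μ (MinTensor B C)) :=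
        LinearMap.range W.toLinearMap
      let h : X → HK := fun x => ⟨W (ket C c F φ x 1), ket C c F φ x 1, rfl⟩
      (∃! PK : L2Module μ (MinTensor B C) →L[ℂ] L2Module μ (MinTensor B C),
        IsKernelOperator μ (repKernel C c F φ) PK) ∧
      (∃! ν : ∀ Δ : Set X, MeasurableSet Δ → HK →L[ℂ] HK,
        IsIntegralOfKetBra (MinTensor B C) μ h ν) ∧
      ∀ (PK : L2Module μ (MinTensor B C) →L[ℂ] L2Module μ (MinTensor B C))
        (ν : ∀ Δ : Set X, MeasurableSet Δ → HK →L[ℂ] HK),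
        IsKernelOperator μ (repKernel C c F φ) PK →
        IsIntegralOfKetBra (MinTensor B C) μ h ν →
        IsOrthogonalProjection HK PK ∧
        IsPOVMeasure (MinTensor B C) ν ∧
        IsPVMeasure (MinTensor B C) (L2Module.indicatorMul μ (MinTensor B C)) ∧
        (∀ (Δ : Set X) (hΔ : MeasurableSet Δ) (f : HK),
          (ν Δ hΔ f : L2Module μ (MinTensor B C)) =
            PK (L2Module.indicatorMul μ (MinTensor B C) Δ hΔ (PK f))) ∧
        (∀ [TopologicalSpace X] [BorelSpace X] [LocallyCompactSpace X] [μ.IsOpenPosMeasure],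
          (∀ x, IsUnit (repKernel C c F φ x x)) →
          IsMinimalDilation HK (L2Module.indicatorMul μ (MinTensor B C))) := by
  obtain ⟨W₀, hW₀, hWi⟩ := hF.exists_isAnalysisMap c
  refine ⟨⟨W₀, hW₀, fun W hW => hW.unique hW₀⟩, fun W hW => ?_⟩
  obtain rfl := hW₀.unique hW
  intro HK h
  have hsep : ∀ a b : MinTensor B C, (∀ φ : MinTensor B C →ₚ[ℂ] ℂ, φ a = φ b) → a = b :=
    fun _ _ => MinTensor.eq_of_forall_functional
  have hk := hF.aestronglyMeasurable_ket c
  obtain ⟨V, hV⟩ := exists_adjoint_of_represents hsep hk W₀ hWi hW₀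
  have hPK : IsKernelOperator μ (repKernel C c F φ) (rangeProjection W₀ V) :=
    isKernelOperator_rangeProjection hW₀ hV
  have hν : IsIntegralOfKetBra (MinTensor B C) μ h (compression W₀ V) :=
    isIntegralOfKetBra_compression hWi hW₀ hV
  refine ⟨⟨_, hPK, fun P hP => hP.unique hsep hPK⟩, ⟨_, hν, fun ν hν' => hν'.unique hsep hν⟩, ?_⟩
  intro PK ν hPK' hν'
  obtain rfl := hPK.unique hsep hPK'
  obtain rfl := hν.unique hsep hν'
  refine ⟨isOrthogonalProjection_rangeProjection hWi hV, isPOVMeasure_compression hWi hV,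
    L2Module.isPVMeasure_indicatorMul μ _, fun Δ hΔ f => ?_, ?_⟩
  · rw [coe_compression, rangeProjection_of_mem hWi hV]
  · intro _ _ _ _ hu
    exact isMinimalDilation_of_isUnit hk hW₀ hu
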